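/- Let $n\ge 0$ and let $\mathfrak g=\mathfrak{gl}_{2n+1}(\mathbb C)$, with matrix units $E_{p,q}$; write $E_k=E_{k,k+1}$, $F_k=E_{k+1,k}$ $(1\le k\le 2n)$ and $H_k=E_{k,k}$ $(1\le k\le 2n+1)$. Let $\theta$ be the Lie algebra automorphism of $\mathfrak g$ with $\theta(E_k)=F_{2n+1-k}$, $\theta(F_k)=E_{2n+1-k}$, $\theta(H_k)=H_{2n+2-k}$, i.e. $\theta(E_{p,q})=E_{2n+2-p,\,2n+2-q}$. Let $\mathfrak g^\theta=\{x\in\mathfrak g: \theta(x)=x\}$, and let $U(\mathfrak g^\theta)$ be its universal enveloping algebra. Consider the following elements of $\mathfrak g^\theta$: $$\mathbf e_i=E_i+F_{2n+1-i},\quad \mathbf f_i=F_i+E_{2n+1-i}\quad(1\le i\le n),$$ $$\mathbf d_i=H_i+H_{2n+2-i}\quad(1\le i\le n),\qquad \mathbf d_{n+1}=2H_{n+1}.$$ Then the unital associative $\mathbb C$-algebra $U(\mathfrak g^\theta)$ is generated by $\mathbf e_1,\dots,\mathbf e_n$, $\mathbf f_1,\dots,\mathbf f_n$, $\mathbf d_1,\dots,\mathbf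 d_{n+1}$, and the following is a complete set of defining relations among these generators (with $1\le i,j\le n$ in relations among the $\mathbf e$'s and $\mathbf f$'s, and $1\le a,b\le n+1$, $1\le j\le n$ in those involving $\mathbf d_a$): \begin{align*} \mathbf d_a\mathbf d_b&=\mathbf d_b\mathbf d_a,\\ [\mathbf d_a,\mathbf e_j]&=(-\delta_{a,j+1}-\delta_{2n+2-a,j+1}+\delta_{a,j})\,\mathbf e_j,\\ [\mathbf d_a,\mathbf f_j]&=(-\delta_{a,j}+\delta_{a,j+1}+\delta_{2n+2-a,j+1})\,\mathbf f_j,\\ \mathbf e_i\mathbf f_j-\mathbf f_j\mathbf e_i&=\delta_{ij}(\mathbf d_i-\mathbf d_{i+1}) && (i,j)\ne(n,n),\\ \mathbf e_i^2\mathbf e_j-2\mathbf e_i\mathbf e_j\mathbf e_i+\mathbf e_j\mathbf e_i^2&=0 && |i-j|=1,\\ \mathbf f_i^2\mathbf f_j-2\mathbf f_i\mathbf f_j\mathbf f_i+\mathbf f_j\mathbf f_i^2&=0 && |i-j|=1,\\ \mathbf e_i\mathbf e_j&=\mathbf e_j\mathbf e_i && |i-j|>1,\\ \mathbf f_i\mathbf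 f_j&=\mathbf f_j\mathbf f_i && |i-j|>1,\\ \mathbf e_n^2\mathbf f_n-2\mathbf e_n\mathbf f_n\mathbf e_n+\mathbf f_n\mathbf e_n^2&=-4\mathbf e_n && (n\ge1),\\ \mathbf f_n^2\mathbf e_n-2\mathbf f_n\mathbf e_n\mathbf f_n+\mathbf e_n\mathbf f_n^2&=-4\mathbf f_n && (n\ge1). \end{align*} In other words, the algebra presented by symbols $e_i,f_i,d_a$ with these relations is isomorphic to $U(\mathfrak g^\theta)$ via $e_i\mapsto\mathbf e_i$, $f_i\mapsto\mathbf f_i$, $d_a\mapsto\mathbf d_a$. -/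

import Mathlib

noncomputable section

namespace FixedPointGL

attribute [local instance 100] LieRing.ofAssociativeRing

/-- The general linear Lie algebra `𝔤 = 𝔤𝔩_{2n+1}(ℂ)`, with the commutator bracket. -/
abbrev MatLie (n : ℕ) : Type := Matrix (Fin (2 * n + 1)) (Fin (2 * n + 1)) ℂ

/- Indices: an element `i : Fin m` stands for the index `i.val + 1 ∈ {1, …, m}`. -/

/-- `E_k`, the matrix unit in position `(k, k + 1)`, for `1 ≤ k ≤ 2n`. -/
def E (n : ℕ) (k : Fin (2 * n)) : MatLie n := Matrix.single k.castSucc k.succ 1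

/-- `F_k`, the matrix unit in position `(k + 1, k)`, for `1 ≤ k ≤ 2n`. -/
def F (n : ℕ) (k : Fin (2 * n)) : MatLie n := Matrix.single k.succ k.castSucc 1

/-- `H_k`, the matrix unit in position `(k, k)`, for `1 ≤ k ≤ 2n + 1`. -/
def H (n : ℕ) (k : Fin (2 * n + 1)) : MatLie n := Matrix.single k k 1

/-- The diagram automorphism `τ(k) = 2n + 1 - k` of the Dynkin diagram `{1, …, 2n}`. -/
def tau (n : ℕ) (k : Fin (2 * n)) : Fin (2 * n) := k.rev

/-- The automorphism `θ` of the Lie algebra `𝔤𝔩_{2n+1}(ℂ)`: it reverses the order of the rows and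
of the columns, so that it sends the matrix unit in position `(p, q)` to the one in position
`(2n + 2 - p, 2n + 2 - q)`. The three lemmas below compute it on `E_k`, `F_k`, `H_k`; as these
generate `𝔤`, the three formulas determine `θ`. -/
def theta (n : ℕ) : MatLie n ≃ₗ⁅ℂ⁆ MatLie n := Matrix.reindexLieEquiv Fin.revPerm

theorem theta_single (n : ℕ) (p q : Fin (2 * n + 1)) :
    theta n (Matrix.single p q 1) = Matrix.single p.rev q.rev 1 := by
  ext a b
  simp [theta, Matrix.single_apply, ← Fin.rev_eq_iff]

theorem theta_E (n : ℕ) (k : Fin (2 * n)) : theta n (E n k) = F n (tau n k) := by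
  simp [E, F, tau, theta_single, Fin.rev_castSucc, Fin.rev_succ]

theorem theta_F (n : ℕ) (k : Fin (2 * n)) : theta n (F n k) = E n (tau n k) := by
  simp [E, F, tau, theta_single, Fin.rev_castSucc, Fin.rev_succ]

/-- `θ(H_k) = H_{2n + 2 - k}`. -/
theorem theta_H (n : ℕ) (k : Fin (2 * n + 1)) : theta n (H n k) = H n k.rev := by
  simp [H, theta_single]

/-- The fixed-point Lie subalgebra `𝔤^θ = {x ∈ 𝔤 | θ(x) = x}`. -/
def fixedSubalgebra (n : ℕ) : LieSubalgebra ℂ (MatLie n) where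
  carrier := {x | theta n x = x}
  add_mem' {x y} hx hy := by
    change theta n x = x at hx
    change theta n y = y at hy
    change theta n (x + y) = x + y
    rw [map_add, hx, hy]
  zero_mem' := map_zero _
  smul_mem' c x hx := by
    change theta n x = x at hx
    change theta n (c • x) = c • x
    rw [map_smul, hx]
  lie_mem' {x y} hx hy := by
    change theta n x = x at hx
    change theta n y = y at hy
    change theta n ⁅x, y⁆ = ⁅x, y⁆
    rw [LieEquiv.map_lie, hx, hy]

/-- The vertex `i ∈ {1, …, n}`, as an element of `{1, …, 2n}`. -/
def vtx (n : ℕ) (i : Fin n) : Fin (2 * n) := Fin.castLE (by omega) i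

/-- The index `a ∈ {1, …, n + 1}`, as an element of `{1, …, 2n + 1}`. -/
def idx (n : ℕ) (a : Fin (n + 1)) : Fin (2 * n + 1) := Fin.castLE (by omega) a

/-- `𝐞_i = E_i + F_{2n + 1 - i}` in `𝔤^θ`, for `1 ≤ i ≤ n`. -/
def eFix (n : ℕ) (i : Fin n) : fixedSubalgebra n :=
  ⟨E n (vtx n i) + F n (tau n (vtx n i)), by
    change theta n _ = _
    rw [map_add, theta_E, theta_F, add_comm]
    simp [tau]⟩

/-- `𝐟_i = F_i + E_{2n + 1 - i}` in `𝔤^θ`, for `1 ≤ i ≤ n`. -/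
def fFix (n : ℕ) (i : Fin n) : fixedSubalgebra n :=
  ⟨F n (vtx n i) + E n (tau n (vtx n i)), by
    change theta n _ = _
    rw [map_add, theta_E, theta_F, add_comm]
    simp [tau]⟩

/-- `𝐝_a = H_a + H_{2n + 2 - a}` in `𝔤^θ`, for `1 ≤ a ≤ n + 1`; in particular
`𝐝_{n + 1} = 2 H_{n + 1}`, see `dFix_last`. -/
def dFix (n : ℕ) (a : Fin (n + 1)) : fixedSubalgebra n :=
  ⟨H n (idx n a) + H n (idx n a).rev, by
    change theta n _ = _
    rw [map_add, theta_H, theta_H, add_comm, Fin.rev_rev]⟩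

theorem dFix_last (n : ℕ) :
    (dFix n (Fin.last n) : MatLie n) = (2 : ℂ) • H n (idx n (Fin.last n)) := by
  have h : (idx n (Fin.last n)).rev = idx n (Fin.last n) := by
    ext
    simp [idx, Fin.val_rev]
    omega
  change H n (idx n (Fin.last n)) + H n (idx n (Fin.last n)).rev = _
  rw [h, two_smul]

/-- `U^j = U(𝔤^θ)`, the universal enveloping algebra of the fixed-point subalgebra. -/
abbrev Uj (n : ℕ) : Type := UniversalEnvelopingAlgebra ℂ (fixedSubalgebra n)

/-- The symbols `e_1, …, e_n, f_1, …, f_n, d_1, …, d_{n + 1}`. -/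
inductive Gen (n : ℕ) : Type
  | e (i : Fin n) : Gen n
  | f (i : Fin n) : Gen n
  | d (a : Fin (n + 1)) : Gen n

/-- The elements of `U(𝔤^θ)` named by the symbols. -/
def genVal (n : ℕ) : Gen n → Uj n
  | .e i => UniversalEnvelopingAlgebra.ι ℂ (eFix n i)
  | .f i => UniversalEnvelopingAlgebra.ι ℂ (fFix n i)
  | .d a => UniversalEnvelopingAlgebra.ι ℂ (dFix n a)

/-- The Kronecker delta. -/
def delta (p q : ℕ) : ℂ := if p = q then 1 else 0

/-- The symbols as elements of the free algebra on them. -/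
abbrev eF (n : ℕ) (i : Fin n) : FreeAlgebra ℂ (Gen n) := FreeAlgebra.ι ℂ (Gen.e i)
abbrev fF (n : ℕ) (i : Fin n) : FreeAlgebra ℂ (Gen n) := FreeAlgebra.ι ℂ (Gen.f i)
abbrev dF (n : ℕ) (a : Fin (n + 1)) : FreeAlgebra ℂ (Gen n) := FreeAlgebra.ι ℂ (Gen.d a)

/-- The defining relations. The index named by `i : Fin m` is `i.val + 1`, which is what the
Kronecker deltas are applied to. -/
inductive Rel (n : ℕ) : FreeAlgebra ℂ (Gen n) → FreeAlgebra ℂ (Gen n) → Prop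
  | dd (a b : Fin (n + 1)) : Rel n (dF n a * dF n b) (dF n b * dF n a)
  | de (a : Fin (n + 1)) (j : Fin n) :
      Rel n (dF n a * eF n j - eF n j * dF n a)
        ((-delta (a.val + 1) ((j.val + 1) + 1)
            - delta (2 * n + 2 - (a.val + 1)) ((j.val + 1) + 1)
            + delta (a.val + 1) (j.val + 1)) • eF n j)
  | df (a : Fin (n + 1)) (j : Fin n) :
      Rel n (dF n a * fF n j - fF n j * dF n a)
        ((-delta (a.val + 1) (j.val + 1)
            + delta (a.val + 1) ((j.val + 1) + 1)
            + delta (2 * n + 2 - (a.val + 1)) ((j.val + 1) + 1)) • fF n j)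
  /-- `[e_i, f_j] = δ_{ij} (d_i - d_{i + 1})` for all `1 ≤ i, j ≤ n` with `(i, j) ≠ (n, n)`. -/
  | ef (i j : Fin n) (hij : ¬ (i.val + 1 = n ∧ j.val + 1 = n)) :
      Rel n (eF n i * fF n j - fF n j * eF n i)
        (delta (i.val + 1) (j.val + 1) • (dF n i.castSucc - dF n i.succ))
  | eSerre (i j : Fin n) (hij : i.val + 1 = j.val ∨ j.val + 1 = i.val) :
      Rel n (eF n i ^ 2 * eF n j - 2 * eF n i * eF n j * eF n i + eF n j * eF n i ^ 2) 0
  | fSerre (i j : Fin n) (hij : i.val + 1 = j.val ∨ j.val + 1 = i.val) :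
      Rel n (fF n i ^ 2 * fF n j - 2 * fF n i * fF n j * fF n i + fF n j * fF n i ^ 2) 0
  | ee (i j : Fin n) (hij : i.val + 1 < j.val ∨ j.val + 1 < i.val) :
      Rel n (eF n i * eF n j) (eF n j * eF n i)
  | ff (i j : Fin n) (hij : i.val + 1 < j.val ∨ j.val + 1 < i.val) :
      Rel n (fF n i * fF n j) (fF n j * fF n i)
  | efn (i : Fin n) (hi : i.val + 1 = n) :
      Rel n (eF n i ^ 2 * fF n i - 2 * eF n i * fF n i * eF n i + fF n i * eF n i ^ 2)
        (-4 * eF n i)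
  | fen (i : Fin n) (hi : i.val + 1 = n) :
      Rel n (fF n i ^ 2 * eF n i - 2 * fF n i * eF n i * fF n i + eF n i * fF n i ^ 2)
        (-4 * fF n i)

/-- The associative unital `ℂ`-algebra given by the generators and the relations above: the free
algebra modulo the two-sided ideal generated by the relations. -/
abbrev Presented (n : ℕ) : Type := RingQuot (Rel n)

/-- The class of a symbol in the presented algebra. -/
def presGen (n : ℕ) (x : Gen n) : Presented n := RingQuot.mkAlgHom ℂ (Rel n) (FreeAlgebra.ι ℂ x)

end FixedPointGL

end

/-!
`𝔤^θ` acts on the vectors fixed and on the vectors negated by the reversal of the coordinates, and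
this identifies it with `𝔤𝔩_{n+1} × 𝔤𝔩_n`, that is, with the Lie algebra spanned by two commuting
systems of matrix units `Q`, `R`. The generators `e`, `f`, `d` are, up to factors of `2` at the
index `n + 1`, the entries on and next to the diagonal of the sum `Q + R`, with `R` put in the upper
left corner.

Conversely, `Q` and `R` can be recovered from the relations in any complex Lie algebra. All the
symbols but `e_n`, `f_n`, `d_{n+1}` satisfy the relations of `𝔤𝔩_n` and so produce matrix units `P`;
by the Serre relations `e_n` and `f_n / 2` generate a vector `a` and a covector `b` under `P`. The
two cubic relations say that `a` and `b` form a last column and a last row not around `P` but around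
`Q i j = [a i, b j] + δ_{ij} d_{n+1} / 2`, and then `R = P - Q` commutes with `Q`, `a` and `b`.
-/

noncomputable section

namespace FixedPointGL

attribute [local instance 100] LieRing.ofAssociativeRing

section MatrixUnits

variable {ι L : Type*} [LieRing L]

/-- The contragredient `-Pᵀ` of a family `P`; its vectors are the covectors of `P`. -/
def dualFamily (P : ι → ι → L) (i j : ι) : L := -P j i

theorem dualFamily_dualFamily (P : ι → ι → L) : dualFamily (dualFamily P) = P := by
  ext i j
  exact neg_neg (P i j)

variable [DecidableEq ι]

/-- The entries `X k l` transform under the `P i j` as the matrix units `E_{k,l}` do under the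
adjoint action of `E_{i,j}`. -/
def IsAdjointFamily (P X : ι → ι → L) : Prop :=
  ∀ i j k l, ⁅P i j, X k l⁆ = (if j = k then X i l else 0) - if i = l then X k j else 0

/-- A system of matrix units up to commutators: the bracket relations of the matrix units
`E_{i,j}` of `𝔤𝔩(ι)`. The `P i j` need not be linearly independent. -/
def IsMatrixUnits (P : ι → ι → L) : Prop := IsAdjointFamily P P

/-- The entries `a k` transform under the `P i j` as the standard basis vectors do under the
matrix units `E_{i,j}`. -/
def IsVector (P : ι → ι → L) (a : ι → L) : Prop :=
  ∀ i j k, ⁅P i j, a k⁆ = if j = k then a i else 0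

variable {P X : ι → ι → L} {a b : ι → L}

theorem IsMatrixUnits.dual (hP : IsMatrixUnits P) : IsMatrixUnits (dualFamily P) := by
  intro i j k l
  simp only [dualFamily, neg_lie, lie_neg, neg_neg, hP j i l k]
  split_ifs <;> abel

theorem isVector_dual_iff :
    IsVector (dualFamily P) b ↔ ∀ i j k, ⁅P i j, b k⁆ = -if i = k then b j else 0 :=
  ⟨fun h i j k => by rw [← h j i k, dualFamily, neg_lie, neg_neg],
    fun h i j k => by rw [dualFamily, neg_lie, h, neg_neg]⟩

theorem IsAdjointFamily.eq_zero (hX : IsAdjointFamily P X) {o : ι} (ho : X o o = 0) (i j : ι) :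
    X i j = 0 := by
  have hcol (k : ι) : X k o = 0 := by
    by_cases hk : k = o
    · rw [hk, ho]
    · simpa [ho, hk] using (hX k o o o).symm
  by_cases hj : j = o
  · rw [hj, hcol]
  · simpa [hcol] using (hX o j i o).symm

theorem IsMatrixUnits.induction_upper {n : ℕ} {P : Fin (n + 1) → Fin (n + 1) → L}
    (hP : IsMatrixUnits P) {S : L → Prop} (hlie : ∀ x y, S x → S y → S ⁅x, y⁆)
    {i j : Fin (n + 1)} (hij : i < j)
    (h : ∀ k : Fin n, i ≤ k.castSucc → k.succ ≤ j → S (P k.castSucc k.succ)) : S (P i j) := by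
  induction j using Fin.induction with
  | zero => exact absurd hij (Fin.not_lt_zero i)
  | succ j ih =>
    obtain rfl | hlt := (Fin.le_castSucc_iff.mpr hij).eq_or_lt
    · exact h j le_rfl le_rfl
    · have hfactor : P i j.succ = ⁅P i j.castSucc, P j.castSucc j.succ⁆ := by
        rw [hP, if_pos rfl, if_neg hij.ne, sub_zero]
      rw [hfactor]
      exact hlie _ _ (ih hlt fun k hik hkj => h k hik (hkj.trans j.castSucc_lt_succ.le))
        (h j hlt.le le_rfl)

theorem IsMatrixUnits.induction_lower {n : ℕ} {P : Fin (n + 1) → Fin (n + 1) → L}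
    (hP : IsMatrixUnits P) {S : L → Prop} (hlie : ∀ x y, S x → S y → S ⁅x, y⁆)
    {i j : Fin (n + 1)} (hji : j < i)
    (h : ∀ k : Fin n, j ≤ k.castSucc → k.succ ≤ i → S (P k.succ k.castSucc)) : S (P i j) := by
  have := hP.dual.induction_upper (S := fun x => S (-x))
    (fun x y hx hy => by simpa using hlie _ _ hy hx) hji
    (fun k hjk hki => by simpa [dualFamily] using h k hjk hki)
  simpa [dualFamily] using this

theorem IsMatrixUnits.induction {n : ℕ} {P : Fin (n + 1) → Fin (n + 1) → L}
    (hP : IsMatrixUnits P) {S : L → Prop} (hlie : ∀ x y, S x → S y → S ⁅x, y⁆)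
    (diag : ∀ i, S (P i i)) (upper : ∀ k : Fin n, S (P k.castSucc k.succ))
    (lower : ∀ k : Fin n, S (P k.succ k.castSucc)) (i j : Fin (n + 1)) : S (P i j) := by
  obtain hij | rfl | hji := lt_trichotomy i j
  · exact hP.induction_upper hlie hij fun k _ _ => upper k
  · exact diag i
  · exact hP.induction_lower hlie hji fun k _ _ => lower k

/-- `v` behaves under `P` as the basis vector of index `o` does under the stabilizer of its line:
it is fixed by `P o o` and killed by every other column of `P`. -/
structure IsBasisWeight (P : ι → ι → L) (o : ι) (v : L) : Prop where
  self : ⁅P o o, v⁆ = v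
  eq_zero : ∀ i j, j ≠ o → ⁅P i j, v⁆ = 0

theorem IsBasisWeight.lie_lie_eq_zero [IsAddTorsionFree L] {o p : ι} {v : L}
    (hv : IsBasisWeight P o v) (hP : IsMatrixUnits P) (hp : p ≠ o)
    (hserre : ⁅P p o, ⁅P p o, v⁆⁆ = 0) {i k : ι} (hi : i ≠ o) (hk : k ≠ o) :
    ⁅P i o, ⁅P k o, v⁆⁆ = 0 := by
  have hmove (r k : ι) (hr : r ≠ o) : ⁅P r p, ⁅P k o, v⁆⁆ = if p = k then ⁅P r o, v⁆ else 0 := by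
    rw [leibniz_lie, hv.eq_zero r p hp, lie_zero, add_zero, hP, if_neg hr, sub_zero]
    split_ifs <;> simp
  have hcomm (i k : ι) (hi : i ≠ o) (hk : k ≠ o) :
      ⁅P i o, ⁅P k o, v⁆⁆ = ⁅P k o, ⁅P i o, v⁆⁆ := by
    rw [leibniz_lie, hP, if_neg hk.symm, if_neg hi, sub_zero, zero_lie, zero_add]
  have hp_right (r : ι) (hr : r ≠ o) : ⁅P r o, ⁅P p o, v⁆⁆ = 0 := by
    have h : ⁅P r p, ⁅P p o, ⁅P p o, v⁆⁆⁆ = 2 • ⁅P r o, ⁅P p o, v⁆⁆ := by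
      rw [leibniz_lie, hP, if_pos rfl, if_neg hr, sub_zero, hmove r p hr, if_pos rfl,
        hcomm p r hp hr, two_nsmul]
    rw [hserre, lie_zero] at h
    exact (nsmul_eq_zero_iff_right two_ne_zero).mp h.symm
  have h : ⁅P k p, ⁅P i o, ⁅P p o, v⁆⁆⁆ = (if p = i then ⁅P k o, ⁅P p o, v⁆⁆ else 0)
      + ⁅P i o, ⁅P k o, v⁆⁆ := by
    rw [leibniz_lie, hP, if_neg hk, sub_zero, hmove k p hk, if_pos rfl]
    split_ifs <;> simp
  simpa [hp_right i hi, hp_right k hk] using h.symm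

theorem IsBasisWeight.isVector [IsAddTorsionFree L] {o : ι} {v : L} (hv : IsBasisWeight P o v)
    (hP : IsMatrixUnits P) (hserre : ∀ i ≠ o, ∃ p ≠ o, ⁅P p o, ⁅P p o, v⁆⁆ = 0) :
    IsVector P fun i => ⁅P i o, v⁆ := by
  intro i j k
  by_cases hj : j = o
  · subst hj
    by_cases hk : j = k
    · subst hk
      simp only [hv.self, if_true]
    rw [if_neg hk]
    by_cases hi : i = j
    · rw [hi, leibniz_lie, hP, if_neg hk, if_pos rfl, hv.self, zero_sub, neg_lie, neg_add_cancel]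
    · obtain ⟨p, hp, hpv⟩ := hserre i hi
      exact hv.lie_lie_eq_zero hP hp hpv hi (Ne.symm hk)
  · rw [leibniz_lie, hv.eq_zero i j hj, lie_zero, add_zero, hP, sub_lie]
    split_ifs <;> simp [hv.eq_zero k j hj]

theorem IsVector.lie_eq_zero (ha : IsVector P a) {o p : ι} (hp : p ≠ o) (hop : ⁅a o, a p⁆ = 0)
    (i j : ι) : ⁅a i, a j⁆ = 0 := by
  have hrow (k : ι) : ⁅a o, a k⁆ = 0 := by
    simpa [ha k p, hp, hop] using (leibniz_lie (P k p) (a o) (a p)).symm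
  have h : ⁅P i o, ⁅a o, a j⁆⁆ = ⁅a i, a j⁆ := by
    rw [leibniz_lie, ha, ha, if_pos rfl]
    split_ifs <;> simp [hrow]
  rw [← h, hrow, lie_zero]

end MatrixUnits

section Bordering

variable {ι L : Type*} [DecidableEq ι] [LieRing L] {P X Y : ι → ι → L} {a b : ι → L} {c : L}

theorem IsAdjointFamily.add (hX : IsAdjointFamily P X) (hY : IsAdjointFamily P Y) :
    IsAdjointFamily P fun i j => X i j + Y i j := by
  intro i j k l
  simp only [lie_add, hX i j k l, hY i j k l]
  split_ifs <;> abel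

theorem IsAdjointFamily.sub (hX : IsAdjointFamily P X) (hY : IsAdjointFamily P Y) :
    IsAdjointFamily P fun i j => X i j - Y i j := by
  intro i j k l
  simp only [lie_sub, hX i j k l, hY i j k l]
  split_ifs <;> abel

theorem isAdjointFamily_scalar (hc : ∀ i j, ⁅P i j, c⁆ = 0) :
    IsAdjointFamily P fun i j => if i = j then c else 0 := by
  intro i j k l
  have hzero : ⁅P i j, if k = l then c else 0⁆ = 0 := by split_ifs <;> simp [hc]
  rw [hzero]
  grind

theorem isAdjointFamily_lie (ha : IsVector P a) (hb : IsVector (dualFamily P) b) :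
    IsAdjointFamily P fun i j => ⁅a i, b j⁆ := by
  intro i j k l
  rw [leibniz_lie, ha, isVector_dual_iff.mp hb]
  split_ifs <;> simp [sub_eq_add_neg]

/-- The brackets of the entries `a i` of a last column, with `(last, last)` entry `c`, among
themselves, with `c`, and with the block `P` left of it, as in a larger system of matrix units.
A last row `b` is a column of `dualFamily P` with `(last, last)` entry `-c`. -/
structure IsColumn (P : ι → ι → L) (a : ι → L) (c : L) : Prop where
  isVector : IsVector P a
  lie_self : ∀ i j, ⁅a i, a j⁆ = 0
  corner_lie : ∀ i, ⁅c, a i⁆ = -a i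

theorem IsColumn.neg (ha : IsColumn P a c) : IsColumn P (fun i => -a i) c where
  isVector i j k := by
    rw [lie_neg, ha.isVector]
    split_ifs <;> simp
  lie_self i j := by simp [ha.lie_self]
  corner_lie i := by simp [ha.corner_lie]

/-- The brackets of a last column `a`, a last row `b` and a `(last, last)` entry `c` around `P`, as
in a larger system of matrix units, except for the brackets `⁅a i, b j⁆`. -/
structure IsBorder (P : ι → ι → L) (a b : ι → L) (c : L) : Prop where
  column : IsColumn P a c
  row : IsColumn (dualFamily P) b (-c)
  lie_corner : ∀ i j, ⁅P i j, c⁆ = 0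

theorem IsBorder.lie_eq (h : IsBorder P a b c) (hP : IsMatrixUnits P) {o : ι}
    (ho : ⁅a o, b o⁆ = P o o - c) (i j : ι) : ⁅a i, b j⁆ = P i j - if i = j then c else 0 := by
  have hdiff := (isAdjointFamily_lie h.column.isVector h.row.isVector).sub
    (IsAdjointFamily.sub hP (isAdjointFamily_scalar h.lie_corner))
  exact sub_eq_zero.mp (hdiff.eq_zero (o := o) (by simp [ho]) i j)

/-- The family `P`, extended by a last column `a`, a last row `b` and a `(last, last)` entry `c`. -/
def bordered {V : Type*} {n : ℕ} (P : Fin n → Fin n → V) (a b : Fin n → V) (c : V) :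
    Fin (n + 1) → Fin (n + 1) → V :=
  Fin.snoc (α := fun _ => Fin (n + 1) → V) (fun i => Fin.snoc (α := fun _ => V) (P i) (a i))
    (Fin.snoc (α := fun _ => V) b c)

section Entries

variable {V : Type*} {n : ℕ} (P : Fin n → Fin n → V) (a b : Fin n → V) (c : V) (i j : Fin n)

@[simp]
theorem bordered_castSucc_castSucc : bordered P a b c i.castSucc j.castSucc = P i j := by
  simp [bordered]

@[simp]
theorem bordered_castSucc_last : bordered P a b c i.castSucc (Fin.last n) = a i := by
  simp [bordered]

@[simp]
theorem bordered_last_castSucc : bordered P a b c (Fin.last n) j.castSucc = b j := by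
  simp [bordered]

@[simp]
theorem bordered_last_last : bordered P a b c (Fin.last n) (Fin.last n) = c := by
  simp [bordered]

end Entries

theorem IsBorder.isMatrixUnits_bordered {n : ℕ} {P : Fin n → Fin n → L} {a b : Fin n → L}
    (h : IsBorder P a b c) (hP : IsMatrixUnits P)
    (hab : ∀ i j, ⁅a i, b j⁆ = P i j - if i = j then c else 0) :
    IsMatrixUnits (bordered P a b c) := by
  have hPa := h.column.isVector
  have hPb := isVector_dual_iff.mp h.row.isVector
  have haP (i j k) : ⁅a k, P i j⁆ = -if j = k then a i else 0 := by rw [← lie_skew, hPa]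
  have hbP (i j k) : ⁅b k, P i j⁆ = if i = k then b j else 0 := by
    rw [← lie_skew, hPb, neg_neg]
  have hba (i j) : ⁅b j, a i⁆ = (if i = j then c else 0) - P i j := by
    rw [← lie_skew, hab, neg_sub]
  have hcb (j) : ⁅c, b j⁆ = b j := by
    simpa [-lie_skew] using h.row.corner_lie j
  have hac (i) : ⁅a i, c⁆ = a i := by rw [← lie_skew, h.column.corner_lie, neg_neg]
  have hbc (j) : ⁅b j, c⁆ = -b j := by rw [← lie_skew, hcb]
  have hcP (i j) : ⁅c, P i j⁆ = 0 := by rw [← lie_skew, h.lie_corner, neg_zero]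
  intro i j k l
  induction i using Fin.lastCases <;> induction j using Fin.lastCases <;>
    induction k using Fin.lastCases <;> induction l using Fin.lastCases <;>
    simp [hP _ _ _ _, hPa _ _ _, hPb, haP, hbP, hab, hba, hcb, hac, hbc, hcP, h.lie_corner,
      h.column.lie_self, h.column.corner_lie, h.row.lie_self, Fin.castSucc_ne_last,
      (Fin.castSucc_ne_last _).symm, eq_comm, -lie_skew]

end Bordering

section Chevalley

variable {L : Type*} {n : ℕ}

/-- The entries of `P` on the diagonal and next to it are `d`, `e` and `f`. -/
structure HasChevalleyGenerators (P : Fin (n + 1) → Fin (n + 1) → L) (e f : Fin n → L)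
    (d : Fin (n + 1) → L) : Prop where
  diag : ∀ a, P a a = d a
  upper : ∀ i : Fin n, P i.castSucc i.succ = e i
  lower : ∀ i : Fin n, P i.succ i.castSucc = f i

theorem HasChevalleyGenerators.bordered {P : Fin (n + 1) → Fin (n + 1) → L} {e f : Fin (n + 1) → L}
    {d : Fin (n + 2) → L}
    (hgen : HasChevalleyGenerators P (e ∘ Fin.castSucc) (f ∘ Fin.castSucc) (d ∘ Fin.castSucc))
    {a b : Fin (n + 1) → L} (ha : a (Fin.last n) = e (Fin.last n))
    (hb : b (Fin.last n) = f (Fin.last n)) :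
    HasChevalleyGenerators (bordered P a b (d (Fin.last (n + 1)))) e f d where
  diag i := by induction i using Fin.lastCases <;> simp [hgen.diag]
  upper i := by
    induction i using Fin.lastCases <;> simp [hgen.upper, ha, Fin.succ_castSucc, -Fin.castSucc_succ]
  lower i := by
    induction i using Fin.lastCases <;> simp [hgen.lower, hb, Fin.succ_castSucc, -Fin.castSucc_succ]

variable [LieRing L]

/-- The relations of the Chevalley generators `e i = E_{i,i+1}`, `f i = E_{i+1,i}`, `d a = E_{a,a}`
of `𝔤𝔩_{n+1}`, except for the brackets `⁅e i, f i⁆`. -/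
structure IsPreChevalley (e f : Fin n → L) (d : Fin (n + 1) → L) : Prop where
  dd : ∀ a b, ⁅d a, d b⁆ = 0
  de : ∀ a j, ⁅d a, e j⁆ = (if a = j.castSucc then e j else 0) - if a = j.succ then e j else 0
  df : ∀ a j, ⁅d a, f j⁆ = (if a = j.succ then f j else 0) - if a = j.castSucc then f j else 0
  ef : ∀ i j, i ≠ j → ⁅e i, f j⁆ = 0
  ee : ∀ i j : Fin n, i.val + 1 < j.val ∨ j.val + 1 < i.val → ⁅e i, e j⁆ = 0
  ff : ∀ i j : Fin n, i.val + 1 < j.val ∨ j.val + 1 < i.val → ⁅f i, f j⁆ = 0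
  eSerre : ∀ i j : Fin n, i.val + 1 = j.val ∨ j.val + 1 = i.val → ⁅e i, ⁅e i, e j⁆⁆ = 0
  fSerre : ∀ i j : Fin n, i.val + 1 = j.val ∨ j.val + 1 = i.val → ⁅f i, ⁅f i, f j⁆⁆ = 0

theorem IsPreChevalley.neg_swap {e f : Fin n → L} {d : Fin (n + 1) → L}
    (h : IsPreChevalley e f d) : IsPreChevalley (-f) (-e) (-d) where
  dd a b := by simp [h.dd]
  de a j := by
    simp only [Pi.neg_apply, neg_lie, lie_neg, neg_neg, h.df]
    split_ifs <;> simp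
  df a j := by
    simp only [Pi.neg_apply, neg_lie, lie_neg, neg_neg, h.de]
    split_ifs <;> simp
  ef i j hij := by
    rw [Pi.neg_apply, Pi.neg_apply, neg_lie, lie_neg, neg_neg, ← lie_skew, h.ef j i hij.symm,
      neg_zero]
  ee i j hij := by simp [h.ff i j hij]
  ff i j hij := by simp [h.ee i j hij]
  eSerre i j hij := by simp [h.fSerre i j hij]
  fSerre i j hij := by simp [h.eSerre i j hij]

theorem HasChevalleyGenerators.neg_swap {P : Fin (n + 1) → Fin (n + 1) → L} {e f : Fin n → L}
    {d : Fin (n + 1) → L} (h : HasChevalleyGenerators P e f d) :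
    HasChevalleyGenerators (dualFamily P) (-f) (-e) (-d) where
  diag a := by simp [dualFamily, h.diag]
  upper i := by simp [dualFamily, h.lower]
  lower i := by simp [dualFamily, h.upper]

variable {P : Fin (n + 1) → Fin (n + 1) → L} {e f : Fin (n + 1) → L} {d : Fin (n + 2) → L}

theorem IsPreChevalley.comp_castSucc (h : IsPreChevalley e f d) :
    IsPreChevalley (e ∘ Fin.castSucc) (f ∘ Fin.castSucc) (d ∘ Fin.castSucc) where
  dd a b := h.dd _ _
  de a j := by simp [h.de, Fin.succ_castSucc, -Fin.castSucc_succ]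
  df a j := by simp [h.df, Fin.succ_castSucc, -Fin.castSucc_succ]
  ef i j hij := h.ef _ _ (by simpa using hij)
  ee i j hij := h.ee _ _ hij
  ff i j hij := h.ff _ _ hij
  eSerre i j hij := h.eSerre _ _ hij
  fSerre i j hij := h.fSerre _ _ hij

theorem IsPreChevalley.lie_last_eq_zero (h : IsPreChevalley e f d) (hP : IsMatrixUnits P)
    (hgen : HasChevalleyGenerators P (e ∘ Fin.castSucc) (f ∘ Fin.castSucc) (d ∘ Fin.castSucc))
    (i j : Fin (n + 1)) : ⁅P i j, d (Fin.last (n + 1))⁆ = 0 := by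
  refine hP.induction (S := fun x => ⁅x, d (Fin.last (n + 1))⁆ = 0)
    (fun x y hx hy => by rw [lie_lie, hx, hy, lie_zero, lie_zero, sub_zero])
    (fun a => ?_) (fun k => ?_) (fun k => ?_) i j
  · simp [hgen.diag, h.dd]
  · rw [hgen.upper, ← lie_skew, Function.comp_apply, h.de]
    simp [Fin.succ_castSucc, -Fin.castSucc_succ, (Fin.castSucc_ne_last _).symm]
  · rw [hgen.lower, ← lie_skew, Function.comp_apply, h.df]
    simp [Fin.succ_castSucc, -Fin.castSucc_succ, (Fin.castSucc_ne_last _).symm]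

theorem IsPreChevalley.isBasisWeight (h : IsPreChevalley e f d) (hP : IsMatrixUnits P)
    (hgen : HasChevalleyGenerators P (e ∘ Fin.castSucc) (f ∘ Fin.castSucc) (d ∘ Fin.castSucc)) :
    IsBasisWeight P (Fin.last n) (e (Fin.last n)) := by
  have hlie (x y : L) (hx : ⁅x, e (Fin.last n)⁆ = 0) (hy : ⁅y, e (Fin.last n)⁆ = 0) :
      ⁅⁅x, y⁆, e (Fin.last n)⁆ = 0 := by
    rw [lie_lie, hx, hy, lie_zero, lie_zero, sub_zero]
  refine ⟨?_, fun i j hj => ?_⟩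
  · rw [hgen.diag, Function.comp_apply, h.de]
    simp [Fin.castSucc_ne_last]
  obtain hij | rfl | hji := lt_trichotomy i j
  · refine hP.induction_upper hlie hij fun k _ hkj => ?_
    rw [hgen.upper]
    exact h.ee _ _ (Or.inl (hkj.trans_lt (Fin.lt_last_iff_ne_last.mpr hj)))
  · rw [hgen.diag, Function.comp_apply, h.de]
    simp [hj, Fin.castSucc_ne_last]
  · refine hP.induction_lower hlie hji fun k _ _ => ?_
    rw [hgen.lower, ← lie_skew]
    simp [h.ef _ _ (Fin.castSucc_ne_last k).symm]

theorem IsPreChevalley.exists_isColumn [IsAddTorsionFree L] (h : IsPreChevalley e f d)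
    (hP : IsMatrixUnits P)
    (hgen : HasChevalleyGenerators P (e ∘ Fin.castSucc) (f ∘ Fin.castSucc) (d ∘ Fin.castSucc)) :
    ∃ a, a (Fin.last n) = e (Fin.last n) ∧ IsColumn P a (d (Fin.last (n + 1))) := by
  have hv := h.isBasisWeight hP hgen
  have hde : ⁅d (Fin.last (n + 1)), e (Fin.last n)⁆ = -e (Fin.last n) := by
    rw [h.de]
    simp [(Fin.castSucc_ne_last _).symm]
  have hserre (i : Fin (n + 1)) (hi : i ≠ Fin.last n) : ∃ p ≠ Fin.last n,
      ⁅P p (Fin.last n), ⁅P p (Fin.last n), e (Fin.last n)⁆⁆ = 0 ∧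
      ⁅e (Fin.last n), ⁅P p (Fin.last n), e (Fin.last n)⁆⁆ = 0 := by
    cases n with
    | zero => exact absurd (Subsingleton.elim (α := Fin 1) _ _) hi
    | succ m =>
      have hp : P (Fin.last m).castSucc (Fin.last (m + 1)) = e (Fin.last m).castSucc :=
        hgen.upper (Fin.last m)
      refine ⟨(Fin.last m).castSucc, Fin.castSucc_ne_last _, ?_, ?_⟩
      · rw [hp, h.eSerre _ _ (by simp)]
      · rw [hp, ← lie_skew (e (Fin.last m).castSucc), lie_neg, h.eSerre _ _ (by simp), neg_zero]
  have ha : IsVector P fun i => ⁅P i (Fin.last n), e (Fin.last n)⁆ :=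
    hv.isVector hP fun i hi => (hserre i hi).imp fun p hp => ⟨hp.1, hp.2.1⟩
  refine ⟨_, hv.self, ha, fun i j => ?_, fun i => ?_⟩
  · by_cases hn : i = Fin.last n ∧ j = Fin.last n
    · rw [hn.1, hn.2, lie_self]
    · obtain ⟨p, hp, -, hcomm⟩ := (not_and_or.mp hn).elim (hserre i) (hserre j)
      exact ha.lie_eq_zero hp (by rwa [hv.self]) i j
  · rw [leibniz_lie, ← lie_skew (d _) (P _ _), h.lie_last_eq_zero hP hgen, hde, neg_zero, zero_lie,
      zero_add, lie_neg]

theorem IsPreChevalley.exists_isBorder [IsAddTorsionFree L] (h : IsPreChevalley e f d)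
    (hP : IsMatrixUnits P)
    (hgen : HasChevalleyGenerators P (e ∘ Fin.castSucc) (f ∘ Fin.castSucc) (d ∘ Fin.castSucc)) :
    ∃ a b, a (Fin.last n) = e (Fin.last n) ∧ b (Fin.last n) = f (Fin.last n) ∧
      IsBorder P a b (d (Fin.last (n + 1))) := by
  obtain ⟨a, ha, hcol⟩ := h.exists_isColumn hP hgen
  obtain ⟨b, hb, hrow⟩ := h.neg_swap.exists_isColumn hP.dual hgen.neg_swap
  exact ⟨a, fun i => -b i, ha, by simp [hb], hcol, hrow.neg, h.lie_last_eq_zero hP hgen⟩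

theorem IsPreChevalley.exists_isMatrixUnits [IsAddTorsionFree L] {e f : Fin n → L}
    {d : Fin (n + 1) → L} (h : IsPreChevalley e f d)
    (hef : ∀ i, ⁅e i, f i⁆ = d i.castSucc - d i.succ) :
    ∃ P, IsMatrixUnits P ∧ HasChevalleyGenerators P e f d := by
  induction n with
  | zero =>
    refine ⟨fun _ _ => d 0, fun i j k l => ?_, fun a => by rw [Subsingleton.elim (α := Fin 1) a 0],
      fun i => i.elim0, fun i => i.elim0⟩
    rw [h.dd, if_pos (Subsingleton.elim (α := Fin 1) j k),
      if_pos (Subsingleton.elim (α := Fin 1) i l), sub_self]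
  | succ n ih =>
    obtain ⟨P, hP, hgen⟩ := ih h.comp_castSucc fun i => by
      simp [hef, Fin.succ_castSucc, -Fin.castSucc_succ]
    obtain ⟨a, b, ha, hb, hborder⟩ := h.exists_isBorder hP hgen
    have hlast : ⁅a (Fin.last n), b (Fin.last n)⁆ =
        P (Fin.last n) (Fin.last n) - d (Fin.last (n + 1)) := by
      rw [ha, hb, hef, hgen.diag, Function.comp_apply, Fin.succ_last]
    exact ⟨_, hborder.isMatrixUnits_bordered hP (hborder.lie_eq hP hlast), hgen.bordered ha hb⟩

end Chevalley

section Splitting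

section Vectors

variable {ι L : Type*} [DecidableEq ι] [LieRing L] {P Q : ι → ι → L} {a b : ι → L} {c : L}

/-- The entries `Z i j k` transform under `P` as the tensors `ε_i ⊗ ε_j* ⊗ ε_k` of basis vectors
do under the matrix units. -/
def IsTripleFamily (P : ι → ι → L) (Z : ι → ι → ι → L) : Prop :=
  ∀ p q i j k, ⁅P p q, Z i j k⁆ =
    (if q = i then Z p j k else 0) - (if p = j then Z i q k else 0) + if q = k then Z i j p else 0

theorem IsTripleFamily.eq_zero [IsAddTorsionFree L] {Z : ι → ι → ι → L}
    (hZ : IsTripleFamily P Z) (hsymm : ∀ i j k, Z i j k = Z k j i) {o : ι} (ho : Z o o o = 0)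
    (i j k : ι) : Z i j k = 0 := by
  have hfirst (i : ι) : Z i o o = 0 := by
    by_cases hi : i = o
    · rw [hi, ho]
    · have h := hZ i o o o o
      rw [ho, lie_zero, if_pos rfl, if_neg hi, if_pos rfl, sub_zero, hsymm o o i, ← two_nsmul] at h
      exact (nsmul_eq_zero_iff_right two_ne_zero).mp h.symm
  have hmiddle (i k : ι) : Z i o k = 0 := by
    by_cases hi : i = o
    · rw [hi, hsymm, hfirst]
    by_cases hk : k = o
    · rw [hk, hfirst]
    simpa [hfirst, hk, Ne.symm hi] using (hZ k o i o o).symm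
  by_cases hj : j = o
  · rw [hj, hmiddle]
  · simpa [hmiddle] using (hZ o j i o k).symm

theorem isTripleFamily_lie_lie (ha : IsVector P a) (hb : IsVector (dualFamily P) b) :
    IsTripleFamily P fun i j k => ⁅⁅a i, b j⁆, a k⁆ := by
  intro p q i j k
  rw [leibniz_lie, isAdjointFamily_lie ha hb, ha]
  split_ifs <;> simp

theorem IsVector.isTripleFamily (ha : IsVector P a) :
    IsTripleFamily P fun i j k => (if j = k then a i else 0) + if i = j then a k else 0 := by
  intro p q i j k
  have hscalar (s : Prop) [Decidable s] (l : ι) :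
      ⁅P p q, if s then a l else 0⁆ = if s then ⁅P p q, a l⁆ else 0 := by split_ifs <;> simp
  simp only [lie_add, hscalar, ha p q]
  grind

theorem lie_lie_column [IsAddTorsionFree L] (ha : IsColumn P a c)
    (hb : IsVector (dualFamily P) b) {o : ι} (ho : ⁅⁅a o, b o⁆, a o⁆ = 2 • a o) (i j k : ι) :
    ⁅⁅a i, b j⁆, a k⁆ = (if j = k then a i else 0) + if i = j then a k else 0 := by
  have hlie := isTripleFamily_lie_lie ha.isVector hb
  have hscalar := ha.isVector.isTripleFamily
  have hdiff : IsTripleFamily P fun i j k =>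
      ⁅⁅a i, b j⁆, a k⁆ - ((if j = k then a i else 0) + if i = j then a k else 0) := by
    intro p q i j k
    simp only [lie_sub, hlie p q i j k, hscalar p q i j k]
    split_ifs <;> abel
  refine sub_eq_zero.mp (hdiff.eq_zero (o := o) (fun i j k => ?_) (by simp [ho, two_nsmul]) i j k)
  have hswap : ⁅⁅a i, b j⁆, a k⁆ = ⁅⁅a k, b j⁆, a i⁆ := by
    rw [lie_lie, ha.lie_self, lie_zero, sub_zero, ← lie_skew (b j), lie_neg, lie_skew]
  grind

theorem IsBorder.of_lie_lie (h : IsBorder P a b c)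
    (haba : ∀ i j k, ⁅⁅a i, b j⁆, a k⁆ = (if j = k then a i else 0) + if i = j then a k else 0)
    (hbab : ∀ i j k, ⁅⁅b i, a j⁆, b k⁆ = (if j = k then b i else 0) + if i = j then b k else 0) :
    IsBorder (fun i j => ⁅a i, b j⁆ + if i = j then c else 0) a b c := by
  have hcb (j) : ⁅c, b j⁆ = b j := by simpa [-lie_skew] using h.row.corner_lie j
  refine ⟨⟨fun i j k => ?_, h.column.lie_self, h.column.corner_lie⟩,
    ⟨isVector_dual_iff.mpr fun i j k => ?_, h.row.lie_self, h.row.corner_lie⟩, fun i j => ?_⟩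
  · have hscalar : ⁅if i = j then c else 0, a k⁆ = -if i = j then a k else 0 := by
      split_ifs <;> simp [h.column.corner_lie]
    rw [add_lie, haba, hscalar, add_neg_cancel_right]
  · have hscalar : ⁅if i = j then c else 0, b k⁆ = if j = i then b k else 0 := by
      split_ifs <;> simp_all
    rw [add_lie, hscalar, ← lie_skew (a i), neg_lie, hbab, neg_add, neg_add_cancel_right]
  · have hscalar : ⁅if i = j then c else 0, c⁆ = 0 := by split_ifs <;> simp
    rw [add_lie, hscalar, add_zero, ← lie_skew, leibniz_lie, h.column.corner_lie, hcb, neg_lie,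
      neg_add_cancel, neg_zero]

theorem IsBorder.isAdjointFamily (h : IsBorder P a b c) :
    IsAdjointFamily P fun i j => ⁅a i, b j⁆ + if i = j then c else 0 :=
  (isAdjointFamily_lie h.column.isVector h.row.isVector).add (isAdjointFamily_scalar h.lie_corner)

/-- Two systems of matrix units that commute with each other, as those of the factors of a
product `𝔤𝔩(ι) × 𝔤𝔩(κ)`. -/
structure IsCommutingPair {κ : Type*} [DecidableEq κ] (Q : ι → ι → L) (R : κ → κ → L) : Prop where
  left : IsMatrixUnits Q
  right : IsMatrixUnits R
  comm : ∀ i j k l, ⁅Q i j, R k l⁆ = 0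

theorem IsMatrixUnits.isCommutingPair_sub (hP : IsMatrixUnits P) (hQ : IsMatrixUnits Q)
    (hPQ : IsAdjointFamily P Q) : IsCommutingPair Q fun i j => P i j - Q i j := by
  have hQP (i j k l) :
      ⁅Q i j, P k l⁆ = (if j = k then Q i l else 0) - if i = l then Q k j else 0 := by
    rw [← lie_skew, hPQ, neg_sub]
    simp only [eq_comm]
  refine ⟨hQ, fun i j k l => ?_, fun i j k l => ?_⟩
  · rw [sub_lie, lie_sub, lie_sub, hP, hPQ, hQP, hQ]
    split_ifs <;> abel
  · rw [lie_sub, hQP, hQ, sub_self]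

end Vectors

variable {L : Type*} [LieRing L] {n : ℕ}

/-- The relations of the generators `e`, `f`, `d` of `𝔤^θ`, with the last `f` and the last `d`
halved. -/
structure IsFixedChevalley (e f : Fin n → L) (d : Fin (n + 1) → L) : Prop
    extends IsPreChevalley e f d where
  ef_diag : ∀ i : Fin n, i.val + 1 < n → ⁅e i, f i⁆ = d i.castSucc - d i.succ
  efe : ∀ i : Fin n, i.val + 1 = n → ⁅⁅e i, f i⁆, e i⁆ = 2 • e i
  fef : ∀ i : Fin n, i.val + 1 = n → ⁅⁅f i, e i⁆, f i⁆ = 2 • f i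

/-- The sum of a family `Q` of size `n + 1` and of a family `R` of size `n` put in its upper left
corner. -/
def cornerSum (Q : Fin (n + 1) → Fin (n + 1) → L) (R : Fin n → Fin n → L) (i j : Fin (n + 1)) : L :=
  Q i j + bordered R 0 0 0 i j

section Entries

variable {Q : Fin (n + 1) → Fin (n + 1) → L} {R : Fin n → Fin n → L}

@[simp]
theorem cornerSum_castSucc_castSucc (i j : Fin n) :
    cornerSum Q R i.castSucc j.castSucc = Q i.castSucc j.castSucc + R i j := by
  simp [cornerSum]

@[simp]
theorem cornerSum_last_left (j : Fin (n + 1)) :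
    cornerSum Q R (Fin.last n) j = Q (Fin.last n) j := by
  induction j using Fin.lastCases <;> simp [cornerSum]

@[simp]
theorem cornerSum_last_right (i : Fin (n + 1)) :
    cornerSum Q R i (Fin.last n) = Q i (Fin.last n) := by
  induction i using Fin.lastCases <;> simp [cornerSum]

end Entries

theorem IsBorder.isCommutingPair_bordered {P Q : Fin n → Fin n → L} {a b : Fin n → L} {c : L}
    (hP : IsBorder P a b c) (hQ : IsBorder Q a b c)
    (hab : ∀ i j, ⁅a i, b j⁆ = Q i j - if i = j then c else 0)
    (hpair : IsCommutingPair Q fun i j => P i j - Q i j) :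
    IsCommutingPair (bordered Q a b c) fun i j => P i j - Q i j := by
  refine ⟨hQ.isMatrixUnits_bordered hpair.left hab, hpair.right, fun i j k l => ?_⟩
  have ha (i) : ⁅a i, P k l - Q k l⁆ = 0 := by
    rw [← lie_skew, sub_lie, hP.column.isVector, hQ.column.isVector, sub_self, neg_zero]
  have hb (j) : ⁅b j, P k l - Q k l⁆ = 0 := by
    rw [← lie_skew, sub_lie, isVector_dual_iff.mp hP.row.isVector,
      isVector_dual_iff.mp hQ.row.isVector, sub_self, neg_zero]
  have hc : ⁅c, P k l - Q k l⁆ = 0 := by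
    rw [← lie_skew, sub_lie, hP.lie_corner, hQ.lie_corner, sub_self, neg_zero]
  induction i using Fin.lastCases <;> induction j using Fin.lastCases <;>
    simp [ha, hb, hc, hpair.comm, -lie_sub]

theorem IsBorder.exists_isCommutingPair [IsAddTorsionFree L] {P : Fin n → Fin n → L}
    {a b : Fin n → L} {c : L} (h : IsBorder P a b c) (hP : IsMatrixUnits P) {o : Fin n}
    (haba : ⁅⁅a o, b o⁆, a o⁆ = 2 • a o) (hbab : ⁅⁅b o, a o⁆, b o⁆ = 2 • b o) :
    ∃ Q R, IsCommutingPair Q R ∧ cornerSum Q R = bordered P a b c := by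
  have ha' : IsVector (dualFamily (dualFamily P)) a := by
    rw [dualFamily_dualFamily]
    exact h.column.isVector
  set Q : Fin n → Fin n → L := fun i j => ⁅a i, b j⁆ + if i = j then c else 0 with hQ_def
  have hQ : IsBorder Q a b c := h.of_lie_lie (lie_lie_column h.column h.row.isVector haba)
    (lie_lie_column h.row ha' hbab)
  have hpair := hP.isCommutingPair_sub hQ.isAdjointFamily h.isAdjointFamily
  refine ⟨_, _, h.isCommutingPair_bordered hQ (fun i j => by simp [hQ_def]) hpair, ?_⟩
  ext i j
  induction i using Fin.lastCases <;> induction j using Fin.lastCases <;> simp [cornerSum]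

theorem IsFixedChevalley.exists_isCommutingPair [IsAddTorsionFree L] {e f : Fin n → L}
    {d : Fin (n + 1) → L} (h : IsFixedChevalley e f d) :
    ∃ Q R, IsCommutingPair Q R ∧ HasChevalleyGenerators (cornerSum Q R) e f d := by
  cases n with
  | zero =>
    obtain ⟨Q, hQ, hgen⟩ := h.exists_isMatrixUnits fun i => i.elim0
    refine ⟨Q, fun i => i.elim0, ⟨hQ, fun i => i.elim0, fun _ _ k => k.elim0⟩, ?_⟩
    refine ⟨fun a => ?_, fun i => i.elim0, fun i => i.elim0⟩
    obtain rfl : a = Fin.last 0 := Subsingleton.elim (α := Fin 1) _ _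
    rw [cornerSum_last_left, hgen.diag]
  | succ n =>
    obtain ⟨P, hP, hgen⟩ := h.comp_castSucc.exists_isMatrixUnits fun i =>
      h.ef_diag i.castSucc (by simp)
    obtain ⟨a, b, ha, hb, hborder⟩ := h.exists_isBorder hP hgen
    obtain ⟨Q, R, hQR, hsum⟩ := hborder.exists_isCommutingPair hP (o := Fin.last n)
      (by rw [ha, hb, h.efe _ (by simp)]) (by rw [ha, hb, h.fef _ (by simp)])
    exact ⟨Q, R, hQR, hsum ▸ hgen.bordered ha hb⟩

variable {Q : Fin (n + 1) → Fin (n + 1) → L} {R : Fin n → Fin n → L}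

theorem IsCommutingPair.lie_left_cornerSum (h : IsCommutingPair Q R) (i j k l : Fin (n + 1)) :
    ⁅Q i j, cornerSum Q R k l⁆ = ⁅Q i j, Q k l⁆ := by
  induction k using Fin.lastCases <;> induction l using Fin.lastCases <;> simp [h.comm]

theorem IsCommutingPair.lie_cornerSum (h : IsCommutingPair Q R) {i j k l : Fin (n + 1)}
    (hjk : j = k → j = Fin.last n → i = Fin.last n ∨ l = Fin.last n)
    (hil : i = l → i = Fin.last n → j = Fin.last n ∨ k = Fin.last n) :
    ⁅cornerSum Q R i j, cornerSum Q R k l⁆ =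
      (if j = k then cornerSum Q R i l else 0) - if i = l then cornerSum Q R k j else 0 := by
  have hRQ (i j k l) : ⁅R i j, Q k l⁆ = 0 := by rw [← lie_skew, h.comm, neg_zero]
  induction i using Fin.lastCases <;> induction j using Fin.lastCases <;>
    induction k using Fin.lastCases <;> induction l using Fin.lastCases <;>
    simp_all [h.left _ _ _ _, h.right _ _ _ _, h.comm, Fin.castSucc_ne_last,
      (Fin.castSucc_ne_last _).symm]
  split_ifs <;> abel

end Splitting

section Generators

variable {L : Type*} [LieRing L] {n : ℕ} {Q : Fin (n + 1) → Fin (n + 1) → L}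
  {R : Fin n → Fin n → L}

theorem IsCommutingPair.isPreChevalley (h : IsCommutingPair Q R) :
    IsPreChevalley (fun i => cornerSum Q R i.castSucc i.succ)
      (fun i => cornerSum Q R i.succ i.castSucc) fun a => cornerSum Q R a a where
  dd a b := by rw [h.lie_cornerSum] <;> grind
  de a j := by rw [h.lie_cornerSum] <;> grind
  df a j := by rw [h.lie_cornerSum] <;> grind
  ef i j hij := by rw [h.lie_cornerSum] <;> grind
  ee i j hij := by rw [h.lie_cornerSum] <;> grind
  ff i j hij := by rw [h.lie_cornerSum] <;> grind
  eSerre i j hij := by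
    have hlie : ⁅cornerSum Q R i.castSucc i.succ, cornerSum Q R j.castSucc j.succ⁆ =
        (if i.succ = j.castSucc then cornerSum Q R i.castSucc j.succ else 0) -
          if i.castSucc = j.succ then cornerSum Q R j.castSucc i.succ else 0 := by
      rw [h.lie_cornerSum] <;> grind
    obtain hij | hij := hij
    · rw [hlie, if_pos (Fin.ext hij), if_neg (by grind), sub_zero, h.lie_cornerSum] <;> grind
    · rw [hlie, if_neg (by grind), if_pos (Fin.ext hij.symm), zero_sub, lie_neg,
        h.lie_cornerSum] <;> grind
  fSerre i j hij := by
    have hlie : ⁅cornerSum Q R i.succ i.castSucc, cornerSum Q R j.succ j.castSucc⁆ =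
        (if i.castSucc = j.succ then cornerSum Q R i.succ j.castSucc else 0) -
          if i.succ = j.castSucc then cornerSum Q R j.succ i.castSucc else 0 := by
      rw [h.lie_cornerSum] <;> grind
    obtain hij | hij := hij
    · rw [hlie, if_neg (by grind), if_pos (Fin.ext hij), zero_sub, lie_neg,
        h.lie_cornerSum] <;> grind
    · rw [hlie, if_pos (Fin.ext hij.symm), if_neg (by grind), sub_zero, h.lie_cornerSum] <;> grind

theorem IsCommutingPair.isFixedChevalley (h : IsCommutingPair Q R) :
    IsFixedChevalley (fun i => cornerSum Q R i.castSucc i.succ)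
      (fun i => cornerSum Q R i.succ i.castSucc) fun a => cornerSum Q R a a where
  toIsPreChevalley := h.isPreChevalley
  ef_diag i hi := by rw [h.lie_cornerSum] <;> grind
  efe i hi := by
    have hlast : i.succ = Fin.last n := Fin.ext hi
    simp [hlast, h.left _ _ _ _, Fin.castSucc_ne_last, (Fin.castSucc_ne_last _).symm, two_nsmul]
  fef i hi := by
    have hlast : i.succ = Fin.last n := Fin.ext hi
    simp [hlast, h.left _ _ _ _, Fin.castSucc_ne_last, (Fin.castSucc_ne_last _).symm, two_nsmul]

variable {K : Type*} [CommRing K] [LieAlgebra K L]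

theorem IsCommutingPair.left_mem (h : IsCommutingPair Q R) (S : LieSubalgebra K L)
    (diag : ∀ a, cornerSum Q R a a ∈ S) (upper : ∀ i : Fin n, cornerSum Q R i.castSucc i.succ ∈ S)
    (lower : ∀ i : Fin n, cornerSum Q R i.succ i.castSucc ∈ S) (i j : Fin (n + 1)) : Q i j ∈ S := by
  have hupper (i : Fin n) (hi : Q i.succ i.succ ∈ S) : Q i.castSucc i.succ ∈ S := by
    have hlie := S.lie_mem hi (upper i)
    rw [h.lie_left_cornerSum, h.left] at hlie
    simpa [Fin.castSucc_lt_succ.ne'] using hlie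
  have hlower (i : Fin n) (hi : Q i.succ i.succ ∈ S) : Q i.succ i.castSucc ∈ S := by
    have hlie := S.lie_mem hi (lower i)
    rw [h.lie_left_cornerSum, h.left] at hlie
    simpa [Fin.castSucc_lt_succ.ne'] using hlie
  have hdiag (a : Fin (n + 1)) : Q a a ∈ S := by
    induction a using Fin.reverseInduction with
    | last => simpa using diag (Fin.last n)
    | cast i hi =>
      have hlie := S.lie_mem (hupper i hi) (lower i)
      rw [h.lie_left_cornerSum, h.left, if_pos rfl, if_pos rfl] at hlie
      simpa using add_mem hlie hi
  exact h.left.induction (fun _ _ => S.lie_mem) hdiag (fun k => hupper k (hdiag _))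
    (fun k => hlower k (hdiag _)) i j

theorem IsCommutingPair.right_mem (h : IsCommutingPair Q R) (S : LieSubalgebra K L)
    (diag : ∀ a, cornerSum Q R a a ∈ S) (upper : ∀ i : Fin n, cornerSum Q R i.castSucc i.succ ∈ S)
    (lower : ∀ i : Fin n, cornerSum Q R i.succ i.castSucc ∈ S) (i j : Fin n) : R i j ∈ S := by
  have hsub (i j : Fin n) (hij : cornerSum Q R i.castSucc j.castSucc ∈ S) : R i j ∈ S := by
    simpa using sub_mem hij (h.left_mem S diag upper lower i.castSucc j.castSucc)
  cases n with
  | zero => exact i.elim0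
  | succ n =>
    exact h.right.induction (fun _ _ => S.lie_mem) (fun a => hsub a a (diag _))
      (fun k => hsub _ _ (upper k.castSucc)) (fun k => hsub _ _ (lower k.castSucc)) i j

end Generators

section MatrixPairs

variable {ι κ K L : Type*} [DecidableEq ι] [DecidableEq κ] [CommRing K] [LieRing L]
  [LieAlgebra K L] {P Q : ι → ι → L} {R : κ → κ → L}

theorem single_lie_single [Fintype ι] (i j k l : ι) (x y : K) :
    ⁅Matrix.single i j x, Matrix.single k l y⁆ =
      (if j = k then Matrix.single i l (x * y) else 0) -
        if i = l then Matrix.single k j (x * y) else 0 := by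
  have hmul (i j k l : ι) (x y : K) : Matrix.single i j x * Matrix.single k l y =
      if j = k then Matrix.single i l (x * y) else 0 := by
    split_ifs with hjk
    · rw [hjk, Matrix.single_mul_single_same]
    · exact Matrix.single_mul_single_of_ne _ _ _ _ hjk _
  rw [Ring.lie_def, hmul, hmul, mul_comm y]
  simp only [eq_comm (a := l)]

theorem isMatrixUnits_single [Fintype ι] :
    IsMatrixUnits fun i j : ι => Matrix.single i j (1 : K) := by
  intro i j k l
  rw [single_lie_single, mul_one]

/-- The standard matrix units of the first factor of `𝔤𝔩(ι) × 𝔤𝔩(κ)`. -/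
def leftUnit (K κ : Type*) [CommRing K] (i j : ι) : Matrix ι ι K × Matrix κ κ K :=
  (Matrix.single i j 1, 0)

/-- The standard matrix units of the second factor of `𝔤𝔩(ι) × 𝔤𝔩(κ)`. -/
def rightUnit (K ι : Type*) [CommRing K] (i j : κ) : Matrix ι ι K × Matrix κ κ K :=
  (0, Matrix.single i j 1)

theorem IsMatrixUnits.map {L' : Type*} [LieRing L'] [LieAlgebra K L'] (hP : IsMatrixUnits P)
    (φ : L →ₗ⁅K⁆ L') : IsMatrixUnits fun i j => φ (P i j) := by
  intro i j k l
  rw [← φ.map_lie, hP, map_sub, apply_ite φ, apply_ite φ, map_zero]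

theorem IsCommutingPair.map {L' : Type*} [LieRing L'] [LieAlgebra K L']
    (h : IsCommutingPair Q R) (φ : L →ₗ⁅K⁆ L') :
    IsCommutingPair (fun i j => φ (Q i j)) fun i j => φ (R i j) :=
  ⟨h.left.map φ, h.right.map φ, fun i j k l => by rw [← φ.map_lie, h.comm, map_zero]⟩

variable [Fintype ι] [Fintype κ]

theorem isCommutingPair_unit :
    IsCommutingPair (leftUnit (ι := ι) K κ) (rightUnit K ι) where
  left := isMatrixUnits_single.map (LieHom.inl K (Matrix ι ι K) (Matrix κ κ K))
  right := isMatrixUnits_single.map (LieHom.inr K (Matrix ι ι K) (Matrix κ κ K))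
  comm i j k l := by simp [leftUnit, rightUnit, LieAlgebra.Prod.bracket_apply]

/-- The linear map that sends the standard matrix unit `E_{i,j}` to `P i j`. -/
def unitMap (P : ι → ι → L) : Matrix ι ι K →ₗ[K] L where
  toFun X := ∑ i, ∑ j, X i j • P i j
  map_add' X Y := by simp only [Matrix.add_apply, add_smul, Finset.sum_add_distrib]
  map_smul' c X := by
    simp only [Matrix.smul_apply, smul_eq_mul, mul_smul, Finset.smul_sum, RingHom.id_apply]

theorem unitMap_single (P : ι → ι → L) (i j : ι) (x : K) :
    unitMap P (Matrix.single i j x) = x • P i j := by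
  simp [unitMap, Matrix.single_apply, ite_and]

theorem IsMatrixUnits.unitMap_lie (hP : IsMatrixUnits P) (X Y : Matrix ι ι K) :
    unitMap P ⁅X, Y⁆ = ⁅unitMap P X, unitMap P Y⁆ := by
  induction X using Matrix.induction_on' with
  | h_zero => simp
  | h_add X X' hX hX' => simp only [add_lie, map_add, hX, hX']
  | h_std_basis i j x =>
    induction Y using Matrix.induction_on' with
    | h_zero => simp
    | h_add Y Y' hY hY' => simp only [lie_add, map_add, hY, hY']
    | h_std_basis k l y =>
      rw [single_lie_single, map_sub, apply_ite (unitMap P), apply_ite (unitMap P), map_zero,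
        unitMap_single, unitMap_single, unitMap_single, unitMap_single, smul_lie, lie_smul, hP,
        smul_smul, smul_sub, smul_ite, smul_ite, smul_zero]

theorem IsCommutingPair.lie_unitMap (h : IsCommutingPair Q R) (X : Matrix ι ι K)
    (Y : Matrix κ κ K) : ⁅unitMap Q X, unitMap R Y⁆ = 0 := by
  simp [unitMap, sum_lie, lie_sum, h.comm]

/-- The homomorphism from `𝔤𝔩(ι) × 𝔤𝔩(κ)` that two commuting systems of matrix units define. -/
def IsCommutingPair.toLieHom (h : IsCommutingPair Q R) :
    Matrix ι ι K × Matrix κ κ K →ₗ⁅K⁆ L where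
  toLinearMap := (unitMap Q).coprod (unitMap R)
  map_lie' {x y} := by
    have hcomm : ⁅unitMap R x.2, unitMap Q y.1⁆ = 0 := by rw [← lie_skew, h.lie_unitMap, neg_zero]
    change unitMap Q ⁅x.1, y.1⁆ + unitMap R ⁅x.2, y.2⁆ =
      ⁅unitMap Q x.1 + unitMap R x.2, unitMap Q y.1 + unitMap R y.2⁆
    rw [h.left.unitMap_lie, h.right.unitMap_lie, lie_add, add_lie, add_lie, hcomm, h.lie_unitMap,
      add_zero, zero_add]

theorem IsCommutingPair.toLieHom_apply (h : IsCommutingPair Q R)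
    (x : Matrix ι ι K × Matrix κ κ K) : h.toLieHom x = unitMap Q x.1 + unitMap R x.2 := rfl

@[simp]
theorem IsCommutingPair.toLieHom_leftUnit (h : IsCommutingPair Q R) (i j : ι) :
    h.toLieHom (leftUnit K κ i j) = Q i j := by
  simp [h.toLieHom_apply, leftUnit, unitMap_single]

@[simp]
theorem IsCommutingPair.toLieHom_rightUnit (h : IsCommutingPair Q R) (i j : κ) :
    h.toLieHom (rightUnit K ι i j) = R i j := by
  simp [h.toLieHom_apply, rightUnit, unitMap_single]

theorem eq_top_of_unit_mem {S : LieSubalgebra K (Matrix ι ι K × Matrix κ κ K)}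
    (hleft : ∀ i j, leftUnit K κ i j ∈ S) (hright : ∀ i j, rightUnit K ι i j ∈ S) : S = ⊤ := by
  refine top_unique fun x _ => ?_
  have hX (X : Matrix ι ι K) : (X, 0) ∈ S := by
    have hsum : (X, 0) = ∑ i, ∑ j, X i j • leftUnit K κ i j := by
      ext1 <;> simp [leftUnit, Prod.fst_sum, Prod.snd_sum, ← Matrix.matrix_eq_sum_single]
    rw [hsum]
    exact sum_mem fun i _ => sum_mem fun j _ => S.smul_mem _ (hleft i j)
  have hY (Y : Matrix κ κ K) : (0, Y) ∈ S := by
    have hsum : (0, Y) = ∑ i, ∑ j, Y i j • rightUnit K ι i j := by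
      ext1 <;> simp [rightUnit, Prod.fst_sum, Prod.snd_sum, ← Matrix.matrix_eq_sum_single]
    rw [hsum]
    exact sum_mem fun i _ => sum_mem fun j _ => S.smul_mem _ (hright i j)
  simpa using add_mem (hX x.1) (hY x.2)

end MatrixPairs

section Blocks

variable {n : ℕ}

theorem idx_injective (n : ℕ) : Function.Injective (idx n) :=
  Fin.castLE_injective (by omega)

theorem rev_idx_last : (idx n (Fin.last n)).rev = idx n (Fin.last n) := by
  ext
  simp [idx, Fin.val_rev]
  omega

theorem rev_idx_eq_idx_iff {i j : Fin (n + 1)} :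
    (idx n i).rev = idx n j ↔ i = Fin.last n ∧ j = Fin.last n := by
  simp only [idx, Fin.ext_iff, Fin.val_rev, Fin.val_castLE, Fin.val_last]
  omega

theorem exists_idx_eq (p : Fin (2 * n + 1)) : ∃ i, p = idx n i ∨ p = (idx n i).rev := by
  obtain h | h := le_or_gt p.val n
  · exact ⟨⟨p, by omega⟩, Or.inl rfl⟩
  · refine ⟨⟨2 * n - p, by omega⟩, Or.inr ?_⟩
    ext
    simp only [idx, Fin.val_rev, Fin.val_castLE]
    omega

/-- The matrix whose columns are the basis `ε_j + ε_{2n+2-j}` (`j ≤ n`), `ε_{n+1}` of the space of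
vectors fixed by the reversal of the coordinates. -/
def symBasis (n : ℕ) : Matrix (Fin (2 * n + 1)) (Fin (n + 1)) ℂ :=
  Matrix.of fun p j => if p = idx n j ∨ p.rev = idx n j then 1 else 0

/-- The matrix whose columns are the basis `ε_j - ε_{2n+2-j}` (`j ≤ n`) of the space of vectors
negated by the reversal of the coordinates. -/
def antiBasis (n : ℕ) : Matrix (Fin (2 * n + 1)) (Fin n) ℂ :=
  Matrix.of fun p j =>
    (if p = idx n j.castSucc then 1 else 0) - if p.rev = idx n j.castSucc then 1 else 0

theorem symBasis_rev (p : Fin (2 * n + 1)) : symBasis n p.rev = symBasis n p := by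
  ext j
  simp [symBasis, or_comm]

theorem symBasis_idx (i : Fin (n + 1)) : symBasis n (idx n i) = (1 : Matrix _ _ ℂ) i := by
  ext j
  have h : idx n i = idx n j ∨ (idx n i).rev = idx n j ↔ i = j := by
    rw [(idx_injective n).eq_iff, rev_idx_eq_idx_iff]
    grind
  simp [symBasis, h, Matrix.one_apply]

theorem antiBasis_rev (p : Fin (2 * n + 1)) : antiBasis n p.rev = -antiBasis n p := by
  ext j
  simp [antiBasis]

theorem antiBasis_idx_castSucc (i : Fin n) :
    antiBasis n (idx n i.castSucc) = (1 : Matrix _ _ ℂ) i := by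
  ext j
  simp [antiBasis, (idx_injective n).eq_iff, rev_idx_eq_idx_iff, Matrix.one_apply,
    Fin.castSucc_ne_last]

theorem antiBasis_idx_last : antiBasis n (idx n (Fin.last n)) = 0 := by
  ext j
  simp [antiBasis, rev_idx_last]

theorem symBasis_mul {κ : Type*} {z : Matrix (Fin (2 * n + 1)) κ ℂ} (hz : ∀ p, z p.rev = z p) :
    symBasis n * z.submatrix (idx n) id = z := by
  have hrow (i) : (symBasis n * z.submatrix (idx n) id) (idx n i) = z (idx n i) := by
    ext k
    simp [Matrix.mul_apply, symBasis_idx, Matrix.one_apply]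
  have hrev (p) : (symBasis n * z.submatrix (idx n) id) p.rev =
      (symBasis n * z.submatrix (idx n) id) p := by
    ext k
    simp only [Matrix.mul_apply, symBasis_rev]
  funext p
  obtain ⟨i, rfl | rfl⟩ := exists_idx_eq p
  · exact hrow i
  · rw [hrev, hrow, hz]

theorem antiBasis_mul {κ : Type*} {z : Matrix (Fin (2 * n + 1)) κ ℂ} (hz : ∀ p, z p.rev = -z p) :
    antiBasis n * z.submatrix (idx n ∘ Fin.castSucc) id = z := by
  set w : Matrix (Fin (2 * n + 1)) κ ℂ :=
    antiBasis n * z.submatrix (idx n ∘ Fin.castSucc) id with hw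
  have hrow (i) : w (idx n i) = z (idx n i) := by
    ext k
    induction i using Fin.lastCases with
    | last =>
      have hmid : z (idx n (Fin.last n)) = 0 :=
        self_eq_neg.mp (by rw [← hz, rev_idx_last])
      simp [hw, Matrix.mul_apply, antiBasis_idx_last, hmid]
    | cast i => simp [hw, Matrix.mul_apply, antiBasis_idx_castSucc, Matrix.one_apply]
  have hrev (p) : w p.rev = -w p := by
    ext k
    simp [hw, Matrix.mul_apply, antiBasis_rev]
  funext p
  obtain ⟨i, rfl | rfl⟩ := exists_idx_eq p
  · exact hrow i
  · rw [hrev, hrow, hz]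

theorem apply_rev_rev (x : fixedSubalgebra n) (p q : Fin (2 * n + 1)) :
    (x : MatLie n) p.rev q.rev = (x : MatLie n) p q := by
  have h : theta n x = x := x.2
  conv_rhs => rw [← h]
  rfl

theorem mul_apply_rev {κ : Type*} (x : fixedSubalgebra n) (z : Matrix (Fin (2 * n + 1)) κ ℂ)
    (p : Fin (2 * n + 1)) (k : κ) :
    ((x : MatLie n) * z) p.rev k = ∑ q, (x : MatLie n) p q * z q.rev k := by
  rw [Matrix.mul_apply, ← Equiv.sum_comp Fin.revPerm]
  simp [apply_rev_rev]

/-- The matrix of `x` on the vectors fixed by the reversal of the coordinates. -/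
def symBlock (n : ℕ) : MatLie n →ₗ[ℂ] Matrix (Fin (n + 1)) (Fin (n + 1)) ℂ where
  toFun x := (x * symBasis n).submatrix (idx n) id
  map_add' x y := by rw [Matrix.add_mul, Matrix.submatrix_add, Pi.add_apply, Pi.add_apply]
  map_smul' c x := by rw [Matrix.smul_mul, Matrix.submatrix_smul]; rfl

/-- The matrix of `x` on the vectors negated by the reversal of the coordinates. -/
def antiBlock (n : ℕ) : MatLie n →ₗ[ℂ] Matrix (Fin n) (Fin n) ℂ where
  toFun x := (x * antiBasis n).submatrix (idx n ∘ Fin.castSucc) id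
  map_add' x y := by rw [Matrix.add_mul, Matrix.submatrix_add, Pi.add_apply, Pi.add_apply]
  map_smul' c x := by rw [Matrix.smul_mul, Matrix.submatrix_smul]; rfl

theorem symBasis_mul_symBlock (x : fixedSubalgebra n) :
    symBasis n * symBlock n x = (x : MatLie n) * symBasis n :=
  symBasis_mul fun p => by
    ext k
    rw [mul_apply_rev, Matrix.mul_apply]
    simp only [symBasis_rev]

theorem antiBasis_mul_antiBlock (x : fixedSubalgebra n) :
    antiBasis n * antiBlock n x = (x : MatLie n) * antiBasis n :=
  antiBasis_mul fun p => by
    ext k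
    rw [mul_apply_rev, Pi.neg_apply, Matrix.mul_apply]
    simp [antiBasis_rev]

theorem symBlock_mul (x : MatLie n) (y : fixedSubalgebra n) :
    symBlock n (x * (y : MatLie n)) = symBlock n x * symBlock n y := by
  change (x * (y : MatLie n) * symBasis n).submatrix (idx n) id = _
  rw [Matrix.mul_assoc, ← symBasis_mul_symBlock, ← Matrix.mul_assoc]
  rfl

theorem antiBlock_mul (x : MatLie n) (y : fixedSubalgebra n) :
    antiBlock n (x * (y : MatLie n)) = antiBlock n x * antiBlock n y := by
  change (x * (y : MatLie n) * antiBasis n).submatrix (idx n ∘ Fin.castSucc) id = _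
  rw [Matrix.mul_assoc, ← antiBasis_mul_antiBlock, ← Matrix.mul_assoc]
  rfl

/-- The homomorphism `𝔤^θ → 𝔤𝔩_{n+1} × 𝔤𝔩_n`. -/
def blocks (n : ℕ) : fixedSubalgebra n →ₗ⁅ℂ⁆
    Matrix (Fin (n + 1)) (Fin (n + 1)) ℂ × Matrix (Fin n) (Fin n) ℂ where
  toLinearMap := ((symBlock n).prod (antiBlock n)).comp (fixedSubalgebra n).toSubmodule.subtype
  map_lie' {x y} := by
    refine Prod.ext ?_ ?_
    · change symBlock n ((x : MatLie n) * y - (y : MatLie n) * x) = _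
      rw [map_sub, symBlock_mul, symBlock_mul]
      rfl
    · change antiBlock n ((x : MatLie n) * y - (y : MatLie n) * x) = _
      rw [map_sub, antiBlock_mul, antiBlock_mul]
      rfl

theorem blocks_injective (n : ℕ) : Function.Injective (blocks n) := by
  rw [injective_iff_map_eq_zero]
  intro x hx
  have hsym : (x : MatLie n) * symBasis n = 0 := by
    rw [← symBasis_mul_symBlock, show symBlock n x = 0 from congrArg Prod.fst hx, Matrix.mul_zero]
  have hanti : (x : MatLie n) * antiBasis n = 0 := by
    rw [← antiBasis_mul_antiBlock, show antiBlock n x = 0 from congrArg Prod.snd hx,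
      Matrix.mul_zero]
  -- The columns `ε_q ± ε_{2n+2-q}` of `1 ± J` lie in the spans of the two bases.
  set J : MatLie n := Matrix.of fun p q => if p.rev = q then 1 else 0 with hJ
  have hsymJ (p) : (1 + J) p.rev = (1 + J) p := by
    ext q
    simp [hJ, Matrix.one_apply, add_comm]
  have hantiJ (p) : (1 - J) p.rev = -(1 - J) p := by
    ext q
    simp [hJ, Matrix.one_apply]
  have hadd : (x : MatLie n) * (1 + J) = 0 := by
    rw [← symBasis_mul hsymJ, ← Matrix.mul_assoc, hsym, Matrix.zero_mul]
  have hsub : (x : MatLie n) * (1 - J) = 0 := by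
    rw [← antiBasis_mul hantiJ, ← Matrix.mul_assoc, hanti, Matrix.zero_mul]
  have hdouble : (2 : ℂ) • (x : MatLie n) = 0 := by
    calc (2 : ℂ) • (x : MatLie n) = x * (1 + J) + x * (1 - J) := by
          rw [mul_add, mul_sub, mul_one]
          module
      _ = 0 := by rw [hadd, hsub, add_zero]
  exact Subtype.ext ((smul_eq_zero_iff_right two_ne_zero).mp hdouble)

/-- The element `E_{k,l} + θ(E_{k,l})` of `𝔤^θ`, for `1 ≤ k, l ≤ n + 1`. -/
def fixUnit (n : ℕ) (k l : Fin (n + 1)) : fixedSubalgebra n :=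
  ⟨Matrix.single (idx n k) (idx n l) 1 + Matrix.single (idx n k).rev (idx n l).rev 1, by
    change theta n _ = _
    rw [map_add, theta_single, theta_single, Fin.rev_rev, Fin.rev_rev, add_comm]⟩

theorem eFix_eq_fixUnit (i : Fin n) : eFix n i = fixUnit n i.castSucc i.succ := by
  apply Subtype.ext
  simp only [eFix, fixUnit, E, F, tau, ← Fin.rev_castSucc, ← Fin.rev_succ]
  rfl

theorem fFix_eq_fixUnit (i : Fin n) : fFix n i = fixUnit n i.succ i.castSucc := by
  apply Subtype.ext
  simp only [fFix, fixUnit, E, F, tau, ← Fin.rev_castSucc, ← Fin.rev_succ]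
  rfl

theorem dFix_eq_fixUnit (a : Fin (n + 1)) : dFix n a = fixUnit n a a := rfl

theorem single_one_mul_apply {ι κ : Type*} [Fintype ι] [DecidableEq ι] (p q r : ι)
    (M : Matrix ι κ ℂ) (j : κ) :
    ((Matrix.single p q 1 : Matrix ι ι ℂ) * M) r j = if r = p then M q j else 0 := by
  by_cases h : r = p
  · simp [h]
  · simp [h, Matrix.single_mul_apply_of_ne]

theorem fixUnit_mul_apply {κ : Type*} (k l r : Fin (n + 1)) (M : Matrix (Fin (2 * n + 1)) κ ℂ)
    (j : κ) : ((fixUnit n k l : MatLie n) * M) (idx n r) j =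
      (if r = k then M (idx n l) j else 0) +
        if r = k ∧ k = Fin.last n then M (idx n l).rev j else 0 := by
  have hrev : idx n r = (idx n k).rev ↔ r = k ∧ k = Fin.last n := by
    rw [eq_comm, rev_idx_eq_idx_iff]
    grind
  rw [fixUnit, Matrix.add_mul, Matrix.add_apply, single_one_mul_apply, single_one_mul_apply]
  simp only [(idx_injective n).eq_iff, hrev]

/-- The factor by which `E_{k,l} + θ(E_{k,l})` differs from the matrix unit `E_{k,l}` on the vectors
fixed by the reversal of the coordinates: it is `2` at the index `n + 1`, which `θ` fixes. -/
def middleFactor (k : Fin (n + 1)) : ℂ := if k = Fin.last n then 2 else 1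

@[simp]
theorem middleFactor_castSucc (i : Fin n) : middleFactor i.castSucc = 1 :=
  if_neg (Fin.castSucc_ne_last i)

@[simp]
theorem middleFactor_last : middleFactor (Fin.last n) = 2 := if_pos rfl

theorem middleFactor_ne_zero (k : Fin (n + 1)) : middleFactor k ≠ 0 := by
  induction k using Fin.lastCases <;> simp

theorem symBlock_fixUnit (k l : Fin (n + 1)) :
    symBlock n (fixUnit n k l) = middleFactor k • Matrix.single k l 1 := by
  ext i j
  change ((fixUnit n k l : MatLie n) * symBasis n) (idx n i) j = _
  rw [fixUnit_mul_apply, symBasis_rev, symBasis_idx]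
  simp only [Matrix.smul_apply, Matrix.single_apply, Matrix.one_apply, smul_eq_mul, middleFactor]
  grind

theorem antiBlock_fixUnit (k l : Fin (n + 1)) :
    antiBlock n (fixUnit n k l) = bordered (fun i j => Matrix.single i j 1) 0 0 0 k l := by
  ext i j
  change ((fixUnit n k l : MatLie n) * antiBasis n) (idx n i.castSucc) j = _
  rw [fixUnit_mul_apply, antiBasis_rev]
  induction k using Fin.lastCases <;> induction l using Fin.lastCases <;>
    simp [antiBasis_idx_last, antiBasis_idx_castSucc, Fin.castSucc_ne_last, Matrix.single_apply,
      Matrix.one_apply, ite_and, eq_comm]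

theorem blocks_fixUnit (k l : Fin (n + 1)) :
    blocks n (fixUnit n k l) = middleFactor k •
      cornerSum (leftUnit ℂ (Fin n)) (rightUnit ℂ (Fin (n + 1))) k l := by
  change (symBlock n (fixUnit n k l), antiBlock n (fixUnit n k l)) = _
  rw [symBlock_fixUnit, antiBlock_fixUnit]
  induction k using Fin.lastCases <;> induction l using Fin.lastCases <;>
    simp [leftUnit, rightUnit]

theorem blocks_surjective (n : ℕ) : Function.Surjective (blocks n) := by
  have hmem (k l) : cornerSum (leftUnit ℂ (Fin n)) (rightUnit ℂ (Fin (n + 1))) k l ∈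
      (blocks n).range := by
    rw [← inv_smul_smul₀ (middleFactor_ne_zero k) (cornerSum _ _ k l), ← blocks_fixUnit]
    exact (blocks n).range.smul_mem _ ((blocks n).mem_range_self _)
  have hpair := isCommutingPair_unit (ι := Fin (n + 1)) (κ := Fin n) (K := ℂ)
  rw [← (blocks n).range_eq_top]
  exact eq_top_of_unit_mem
    (hpair.left_mem _ (fun a => hmem a a) (fun i => hmem _ _) fun i => hmem _ _)
    (hpair.right_mem _ (fun a => hmem a a) (fun i => hmem _ _) fun i => hmem _ _)

/-- The isomorphism `𝔤^θ ≃ 𝔤𝔩_{n+1} × 𝔤𝔩_n`. -/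
def blocksEquiv (n : ℕ) : fixedSubalgebra n ≃ₗ⁅ℂ⁆
    Matrix (Fin (n + 1)) (Fin (n + 1)) ℂ × Matrix (Fin n) (Fin n) ℂ :=
  LieEquiv.ofBijective (blocks n) ⟨blocks_injective n, blocks_surjective n⟩

end Blocks
section Relations

variable {n : ℕ} {L : Type*} [LieRing L] [LieAlgebra ℂ L]

/-- The Lie algebra version of the defining relations, for the values `g` of the symbols. -/
structure HasLieRelations (g : Gen n → L) : Prop where
  dd : ∀ a b, ⁅g (.d a), g (.d b)⁆ = 0
  de : ∀ (a : Fin (n + 1)) (j : Fin n), ⁅g (.d a), g (.e j)⁆ =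
    (-delta (a.val + 1) ((j.val + 1) + 1) - delta (2 * n + 2 - (a.val + 1)) ((j.val + 1) + 1)
      + delta (a.val + 1) (j.val + 1)) • g (.e j)
  df : ∀ (a : Fin (n + 1)) (j : Fin n), ⁅g (.d a), g (.f j)⁆ =
    (-delta (a.val + 1) (j.val + 1) + delta (a.val + 1) ((j.val + 1) + 1)
      + delta (2 * n + 2 - (a.val + 1)) ((j.val + 1) + 1)) • g (.f j)
  ef : ∀ i j : Fin n, ¬ (i.val + 1 = n ∧ j.val + 1 = n) → ⁅g (.e i), g (.f j)⁆ =
    delta (i.val + 1) (j.val + 1) • (g (.d i.castSucc) - g (.d i.succ))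
  eSerre : ∀ i j : Fin n, i.val + 1 = j.val ∨ j.val + 1 = i.val →
    ⁅g (.e i), ⁅g (.e i), g (.e j)⁆⁆ = 0
  fSerre : ∀ i j : Fin n, i.val + 1 = j.val ∨ j.val + 1 = i.val →
    ⁅g (.f i), ⁅g (.f i), g (.f j)⁆⁆ = 0
  ee : ∀ i j : Fin n, i.val + 1 < j.val ∨ j.val + 1 < i.val → ⁅g (.e i), g (.e j)⁆ = 0
  ff : ∀ i j : Fin n, i.val + 1 < j.val ∨ j.val + 1 < i.val → ⁅g (.f i), g (.f j)⁆ = 0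
  efn : ∀ i : Fin n, i.val + 1 = n → ⁅g (.e i), ⁅g (.e i), g (.f i)⁆⁆ = (-4 : ℂ) • g (.e i)
  fen : ∀ i : Fin n, i.val + 1 = n → ⁅g (.f i), ⁅g (.f i), g (.e i)⁆⁆ = (-4 : ℂ) • g (.f i)

theorem serre_eq_lie_lie {A : Type*} [Ring A] (x y : A) :
    x ^ 2 * y - 2 * x * y * x + y * x ^ 2 = ⁅x, ⁅x, y⁆⁆ := by
  simp only [Ring.lie_def]
  noncomm_ring

section Enveloping

variable {A : Type*} [Ring A] [Algebra ℂ A]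

theorem neg_four_smul (x : A) : (-4 : ℂ) • x = -4 * x := by
  rw [Algebra.smul_def, map_neg, map_ofNat]

theorem HasLieRelations.lift_eq {g : Gen n → A} (hg : HasLieRelations g)
    {x y : FreeAlgebra ℂ (Gen n)} (hxy : Rel n x y) :
    FreeAlgebra.lift ℂ g x = FreeAlgebra.lift ℂ g y := by
  cases hxy <;> simp only [map_mul, map_add, map_sub, map_pow, map_ofNat, map_neg, map_smul,
    map_zero, FreeAlgebra.lift_ι_apply]
  case dd a b => exact sub_eq_zero.mp (hg.dd a b)
  case de a j => exact hg.de a j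
  case df a j => exact hg.df a j
  case ef i j hij => exact hg.ef i j hij
  case eSerre i j hij => rw [serre_eq_lie_lie, hg.eSerre i j hij]
  case fSerre i j hij => rw [serre_eq_lie_lie, hg.fSerre i j hij]
  case ee i j hij => exact sub_eq_zero.mp (hg.ee i j hij)
  case ff i j hij => exact sub_eq_zero.mp (hg.ff i j hij)
  case efn i hi => rw [serre_eq_lie_lie, hg.efn i hi, neg_four_smul]
  case fen i hi => rw [serre_eq_lie_lie, hg.fen i hi, neg_four_smul]

theorem hasLieRelations_of_lift_eq {g : Gen n → A}
    (hg : ∀ x y, Rel n x y → FreeAlgebra.lift ℂ g x = FreeAlgebra.lift ℂ g y) :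
    HasLieRelations g where
  dd a b := sub_eq_zero.mpr (by simpa using hg _ _ (.dd a b))
  de a j := by simpa [Ring.lie_def] using hg _ _ (.de a j)
  df a j := by simpa [Ring.lie_def] using hg _ _ (.df a j)
  ef i j hij := by simpa [Ring.lie_def] using hg _ _ (.ef i j hij)
  eSerre i j hij := by
    rw [← serre_eq_lie_lie]
    simpa only [map_mul, map_add, map_sub, map_pow, map_ofNat, map_neg, map_zero,
      FreeAlgebra.lift_ι_apply] using hg _ _ (.eSerre i j hij)
  fSerre i j hij := by
    rw [← serre_eq_lie_lie]
    simpa only [map_mul, map_add, map_sub, map_pow, map_ofNat, map_neg, map_zero,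
      FreeAlgebra.lift_ι_apply] using hg _ _ (.fSerre i j hij)
  ee i j hij := sub_eq_zero.mpr (by simpa using hg _ _ (.ee i j hij))
  ff i j hij := sub_eq_zero.mpr (by simpa using hg _ _ (.ff i j hij))
  efn i hi := by
    rw [← serre_eq_lie_lie, neg_four_smul]
    simpa only [map_mul, map_add, map_sub, map_pow, map_ofNat, map_neg, map_zero,
      FreeAlgebra.lift_ι_apply] using hg _ _ (.efn i hi)
  fen i hi := by
    rw [← serre_eq_lie_lie, neg_four_smul]
    simpa only [map_mul, map_add, map_sub, map_pow, map_ofNat, map_neg, map_zero,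
      FreeAlgebra.lift_ι_apply] using hg _ _ (.fen i hi)

end Enveloping

theorem delta_e (a : Fin (n + 1)) (j : Fin n) :
    -delta (a.val + 1) ((j.val + 1) + 1) - delta (2 * n + 2 - (a.val + 1)) ((j.val + 1) + 1)
        + delta (a.val + 1) (j.val + 1) =
      middleFactor a * ((if a = j.castSucc then 1 else 0) - if a = j.succ then 1 else 0) := by
  simp only [delta, middleFactor, Fin.ext_iff, Fin.val_last, Fin.val_castSucc, Fin.val_succ]
  split_ifs <;> first | (exfalso; omega) | norm_num

theorem delta_f (a : Fin (n + 1)) (j : Fin n) :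
    -delta (a.val + 1) (j.val + 1) + delta (a.val + 1) ((j.val + 1) + 1)
        + delta (2 * n + 2 - (a.val + 1)) ((j.val + 1) + 1) =
      middleFactor a * ((if a = j.succ then 1 else 0) - if a = j.castSucc then 1 else 0) := by
  simp only [delta, middleFactor, Fin.ext_iff, Fin.val_last, Fin.val_castSucc, Fin.val_succ]
  split_ifs <;> first | (exfalso; omega) | norm_num

/-- The values of the symbols that correspond to the generators `e`, `f`, `d` of
`IsFixedChevalley`, whose last `f` and last `d` are halved. -/
def rescale (e f : Fin n → L) (d : Fin (n + 1) → L) : Gen n → L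
  | .e i => middleFactor i.castSucc • e i
  | .f i => middleFactor i.succ • f i
  | .d a => middleFactor a • d a

theorem exists_rescale_eq (g : Gen n → L) : ∃ e f d, rescale e f d = g := by
  refine ⟨fun i => (middleFactor i.castSucc)⁻¹ • g (.e i),
    fun i => (middleFactor i.succ)⁻¹ • g (.f i), fun a => (middleFactor a)⁻¹ • g (.d a), ?_⟩
  ext x
  cases x <;> exact smul_inv_smul₀ (middleFactor_ne_zero _) _

theorem middleFactor_lie_eq_iff {a k : Fin (n + 1)} {x y : L} {s t : Prop} [Decidable s]
    [Decidable t] :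
    ⁅middleFactor a • x, middleFactor k • y⁆ =
        (middleFactor a * ((if s then 1 else 0) - if t then 1 else 0)) • middleFactor k • y ↔
      ⁅x, y⁆ = (if s then y else 0) - if t then y else 0 := by
  rw [smul_lie, lie_smul, mul_smul, smul_right_inj (middleFactor_ne_zero a), smul_comm _
    (middleFactor k), smul_right_inj (middleFactor_ne_zero k), sub_smul, ite_smul, ite_smul,
    one_smul, zero_smul]

theorem lie_lie_eq_neg_four_smul_iff {x y : L} :
    ⁅x, ⁅x, (2 : ℂ) • y⁆⁆ = (-4 : ℂ) • x ↔ ⁅⁅x, y⁆, x⁆ = 2 • x := by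
  have hleft : ⁅x, ⁅x, (2 : ℂ) • y⁆⁆ = (-2 : ℂ) • ⁅⁅x, y⁆, x⁆ := by
    rw [lie_smul, lie_smul, ← lie_skew x, smul_neg, neg_smul]
  have hright : (-4 : ℂ) • x = (-2 : ℂ) • 2 • x := by module
  rw [hleft, hright, smul_right_inj (by norm_num)]

theorem HasLieRelations.isFixedChevalley {e f : Fin n → L} {d : Fin (n + 1) → L}
    (h : HasLieRelations (rescale e f d)) : IsFixedChevalley e f d where
  dd a b := by simpa [rescale, middleFactor_ne_zero] using h.dd a b
  de a j := middleFactor_lie_eq_iff.mp ((h.de a j).trans (by rw [delta_e]; rfl))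
  df a j := middleFactor_lie_eq_iff.mp ((h.df a j).trans (by rw [delta_f]; rfl))
  ef i j hij := by
    have := h.ef i j (by grind)
    simpa [rescale, middleFactor_ne_zero, delta, Fin.val_inj, hij] using this
  ee i j hij := by simpa [rescale] using h.ee i j hij
  ff i j hij := by simpa [rescale, middleFactor_ne_zero] using h.ff i j hij
  eSerre i j hij := by simpa [rescale] using h.eSerre i j hij
  fSerre i j hij := by simpa [rescale, middleFactor_ne_zero] using h.fSerre i j hij
  ef_diag i hi := by
    have hsucc : middleFactor i.succ = 1 := if_neg (by grind)
    simpa [rescale, hsucc, delta] using h.ef i i (by grind)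
  efe i hi := by
    have hsucc : middleFactor i.succ = 2 := if_pos (by grind)
    refine lie_lie_eq_neg_four_smul_iff.mp ?_
    simpa only [rescale, middleFactor_castSucc, one_smul, hsucc] using h.efn i hi
  fef i hi := by
    have hsucc : middleFactor i.succ = 2 := if_pos (by grind)
    refine lie_lie_eq_neg_four_smul_iff.mp ((smul_right_inj (two_ne_zero' ℂ)).mp ?_)
    simpa [rescale, hsucc, smul_comm (2 : ℂ) (4 : ℂ)] using h.fen i hi

theorem IsFixedChevalley.hasLieRelations {e f : Fin n → L} {d : Fin (n + 1) → L}
    (h : IsFixedChevalley e f d) : HasLieRelations (rescale e f d) where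
  dd a b := by simp [rescale, h.dd]
  de a j := (middleFactor_lie_eq_iff.mpr (h.de a j)).trans (by rw [delta_e]; rfl)
  df a j := (middleFactor_lie_eq_iff.mpr (h.df a j)).trans (by rw [delta_f]; rfl)
  ef i j hij := by
    obtain rfl | hne := eq_or_ne i j
    · have hsucc : middleFactor i.succ = 1 := if_neg (by grind)
      simp [rescale, hsucc, delta, h.ef_diag i (by grind)]
    · simp [rescale, delta, Fin.val_inj, hne, h.ef i j hne]
  ee i j hij := by simp [rescale, h.ee i j hij]
  ff i j hij := by simp [rescale, h.ff i j hij]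
  eSerre i j hij := by simp [rescale, h.eSerre i j hij]
  fSerre i j hij := by simp [rescale, h.fSerre i j hij]
  efn i hi := by
    have hsucc : middleFactor i.succ = 2 := if_pos (by grind)
    simpa only [rescale, middleFactor_castSucc, one_smul, hsucc] using
      lie_lie_eq_neg_four_smul_iff.mpr (h.efe i hi)
  fen i hi := by
    have hsucc : middleFactor i.succ = 2 := if_pos (by grind)
    have hlie := congrArg ((2 : ℂ) • ·) (lie_lie_eq_neg_four_smul_iff.mpr (h.fef i hi))
    simpa [rescale, hsucc, smul_comm (2 : ℂ) (4 : ℂ)] using hlie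

/-- The elements of `𝔤^θ` named by the symbols. -/
def genFix (n : ℕ) : Gen n → fixedSubalgebra n
  | .e i => eFix n i
  | .f i => fFix n i
  | .d a => dFix n a

theorem HasChevalleyGenerators.map_genFix {P : Fin (n + 1) → Fin (n + 1) → L} {e f : Fin n → L}
    {d : Fin (n + 1) → L} (h : HasChevalleyGenerators P e f d) {φ : fixedSubalgebra n →ₗ⁅ℂ⁆ L}
    (hφ : ∀ k l, φ (fixUnit n k l) = middleFactor k • P k l) (x : Gen n) :
    φ (genFix n x) = rescale e f d x := by
  cases x with
  | e i => rw [genFix, eFix_eq_fixUnit, hφ, h.upper]; rfl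
  | f i => rw [genFix, fFix_eq_fixUnit, hφ, h.lower]; rfl
  | d a => rw [genFix, dFix_eq_fixUnit, hφ, h.diag]; rfl

theorem HasLieRelations.exists_lieHom {g : Gen n → L} (hg : HasLieRelations g) :
    ∃ φ : fixedSubalgebra n →ₗ⁅ℂ⁆ L, ∀ x, φ (genFix n x) = g x := by
  have := IsAddTorsionFree.of_isTorsionFree ℂ L
  obtain ⟨e, f, d, rfl⟩ := exists_rescale_eq g
  obtain ⟨Q, R, hQR, hgen⟩ := hg.isFixedChevalley.exists_isCommutingPair
  refine ⟨hQR.toLieHom.comp (blocks n), hgen.map_genFix fun k l => ?_⟩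
  rw [LieHom.comp_apply, blocks_fixUnit, map_smul]
  induction k using Fin.lastCases <;> induction l using Fin.lastCases <;> simp

theorem blocksEquiv_symm_cornerSum (k l : Fin (n + 1)) :
    (blocksEquiv n).symm (cornerSum (leftUnit ℂ (Fin n)) (rightUnit ℂ (Fin (n + 1))) k l) =
      (middleFactor k)⁻¹ • fixUnit n k l := by
  have h : blocksEquiv n ((middleFactor k)⁻¹ • fixUnit n k l) =
      cornerSum (leftUnit ℂ (Fin n)) (rightUnit ℂ (Fin (n + 1))) k l := by
    change blocks n _ = _
    rw [map_smul, blocks_fixUnit, inv_smul_smul₀ (middleFactor_ne_zero k)]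
  rw [← h, LieEquiv.symm_apply_apply]

theorem hasLieRelations_map_genFix (φ : fixedSubalgebra n →ₗ⁅ℂ⁆ L) :
    HasLieRelations fun x => φ (genFix n x) := by
  set ψ := φ.comp (blocksEquiv n).symm.toLieHom with hψ
  have hpair := isCommutingPair_unit.map ψ
  have hcorner (k l) : φ (fixUnit n k l) = middleFactor k •
      cornerSum (fun i j => ψ (leftUnit ℂ (Fin n) i j))
        (fun i j => ψ (rightUnit ℂ (Fin (n + 1)) i j)) k l := by
    rw [eq_comm, ← eq_inv_smul_iff₀ (middleFactor_ne_zero k), ← map_smul,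
      ← blocksEquiv_symm_cornerSum]
    induction k using Fin.lastCases <;> induction l using Fin.lastCases <;> simp [hψ]
  have hgen := HasChevalleyGenerators.map_genFix ⟨fun _ => rfl, fun _ => rfl, fun _ => rfl⟩ hcorner
  simpa only [hgen] using hpair.isFixedChevalley.hasLieRelations

/-- The Lie subalgebra on which two homomorphisms agree. -/
def lieEqLocus {K L L' : Type*} [CommRing K] [LieRing L] [LieAlgebra K L] [LieRing L']
    [LieAlgebra K L'] (φ ψ : L →ₗ⁅K⁆ L') : LieSubalgebra K L :=
  { LinearMap.eqLocus (φ : L →ₗ[K] L') (ψ : L →ₗ[K] L') with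
    lie_mem' := fun {x y} (hx : φ x = ψ x) (hy : φ y = ψ y) =>
      show φ ⁅x, y⁆ = ψ ⁅x, y⁆ by rw [φ.map_lie, ψ.map_lie, hx, hy] }

theorem lieHom_ext_genFix {φ ψ : fixedSubalgebra n →ₗ⁅ℂ⁆ L}
    (h : ∀ x, φ (genFix n x) = ψ (genFix n x)) : φ = ψ := by
  let S := lieEqLocus (φ.comp (blocksEquiv n).symm.toLieHom) (ψ.comp (blocksEquiv n).symm.toLieHom)
  have hmem (x : Gen n) (k l) (hx : genFix n x = fixUnit n k l) :
      cornerSum (leftUnit ℂ (Fin n)) (rightUnit ℂ (Fin (n + 1))) k l ∈ S := by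
    change φ ((blocksEquiv n).symm _) = ψ ((blocksEquiv n).symm _)
    rw [blocksEquiv_symm_cornerSum, map_smul, map_smul, ← hx, h]
  have hdiag (a) := hmem (.d a) _ _ (dFix_eq_fixUnit a)
  have hupper (i) := hmem (.e i) _ _ (eFix_eq_fixUnit i)
  have hlower (i) := hmem (.f i) _ _ (fFix_eq_fixUnit i)
  have hpair := isCommutingPair_unit (ι := Fin (n + 1)) (κ := Fin n) (K := ℂ)
  have htop : S = ⊤ := eq_top_of_unit_mem (hpair.left_mem S hdiag hupper hlower)
    (hpair.right_mem S hdiag hupper hlower)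
  ext x
  have hx : blocksEquiv n x ∈ S := htop ▸ LieSubalgebra.mem_top _
  change φ ((blocksEquiv n).symm _) = ψ ((blocksEquiv n).symm _) at hx
  rwa [LieEquiv.symm_apply_apply] at hx

end Relations
section Presentation

variable {n : ℕ}

theorem genVal_eq (x : Gen n) : genVal n x = UniversalEnvelopingAlgebra.ι ℂ (genFix n x) := by
  cases x <;> rfl

theorem hasLieRelations_genVal (n : ℕ) : HasLieRelations (genVal n) := by
  rw [funext genVal_eq]
  exact hasLieRelations_map_genFix (UniversalEnvelopingAlgebra.ι ℂ)

theorem lift_presGen (n : ℕ) :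
    FreeAlgebra.lift ℂ (presGen n) = RingQuot.mkAlgHom ℂ (Rel n) := by
  refine FreeAlgebra.hom_ext (funext fun x => ?_)
  rw [Function.comp_apply, FreeAlgebra.lift_ι_apply]
  rfl

theorem hasLieRelations_presGen (n : ℕ) : HasLieRelations (presGen n) :=
  hasLieRelations_of_lift_eq fun x y hxy => by
    rw [lift_presGen]
    exact RingQuot.mkAlgHom_rel ℂ hxy

theorem adjoin_range_presGen (n : ℕ) : Algebra.adjoin ℂ (Set.range (presGen n)) = ⊤ := by
  rw [show presGen n = RingQuot.mkAlgHom ℂ (Rel n) ∘ FreeAlgebra.ι ℂ from rfl, Set.range_comp,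
    ← AlgHom.map_adjoin, FreeAlgebra.adjoin_range_ι, Algebra.map_top, AlgHom.range_eq_top]
  exact RingQuot.mkAlgHom_surjective ℂ (Rel n)

/-- The homomorphism from the presented algebra to `U(𝔤^θ)` that sends each symbol to the element
it names. -/
def presHom (n : ℕ) : Presented n →ₐ[ℂ] Uj n :=
  RingQuot.liftAlgHom ℂ
    ⟨FreeAlgebra.lift ℂ (genVal n), fun _ _ => (hasLieRelations_genVal n).lift_eq⟩

theorem presHom_presGen (x : Gen n) : presHom n (presGen n x) = genVal n x := by
  rw [presHom, presGen, RingQuot.liftAlgHom_mkAlgHom_apply, FreeAlgebra.lift_ι_apply]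

theorem exists_presEquiv (n : ℕ) :
    ∃ Φ : Presented n ≃ₐ[ℂ] Uj n, ∀ x : Gen n, Φ (presGen n x) = genVal n x := by
  obtain ⟨ψ, hψ⟩ := (hasLieRelations_presGen n).exists_lieHom
  have hlift (x) : UniversalEnvelopingAlgebra.lift ℂ ψ (genVal n x) = presGen n x := by
    rw [genVal_eq, UniversalEnvelopingAlgebra.lift_ι_apply, hψ]
  refine ⟨AlgEquiv.ofAlgHom (presHom n) (UniversalEnvelopingAlgebra.lift ℂ ψ) ?_ ?_,
    presHom_presGen⟩
  · refine UniversalEnvelopingAlgebra.hom_ext ℂ (lieHom_ext_genFix fun x => ?_)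
    change presHom n (UniversalEnvelopingAlgebra.lift ℂ ψ (UniversalEnvelopingAlgebra.ι ℂ _)) =
      UniversalEnvelopingAlgebra.ι ℂ (genFix n x)
    rw [← genVal_eq, hlift, presHom_presGen]
  · refine RingQuot.ringQuot_ext' ℂ _ _ (FreeAlgebra.hom_ext (funext fun x => ?_))
    change UniversalEnvelopingAlgebra.lift ℂ ψ (presHom n (presGen n x)) = presGen n x
    rw [presHom_presGen, hlift]

end Presentation

end FixedPointGL

end

theorem mainTheorem2 (n : ℕ) :
    Algebra.adjoin ℂ (Set.range (FixedPointGL.genVal n)) = ⊤ ∧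
    ∃ Φ : FixedPointGL.Presented n ≃ₐ[ℂ] FixedPointGL.Uj n,
      ∀ x : FixedPointGL.Gen n, Φ (FixedPointGL.presGen n x) = FixedPointGL.genVal n x := by
  obtain ⟨Φ, hΦ⟩ := FixedPointGL.exists_presEquiv n
  refine ⟨?_, Φ, hΦ⟩
  have hgen : FixedPointGL.genVal n = (Φ : _ →ₐ[ℂ] _) ∘ FixedPointGL.presGen n :=
    funext fun x => (hΦ x).symm
  rw [hgen, Set.range_comp, ← AlgHom.map_adjoin, FixedPointGL.adjoin_range_presGen,
    Algebra.map_top, AlgHom.range_eq_top]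
  exact Φ.surjective
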